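/- Let $K$ be an algebraically closed field and let $Q$ be a Dynkin quiver, i.e. a finite quiver whose underlying graph is a disjoint union of simply laced Dynkin diagrams $\mathbb{A}_n$ ($n\ge 1$), $\mathbb{D}_n$ ($n\ge 4$), $\mathbb{E}_6$, $\mathbb{E}_7$, $\mathbb{E}_8$ (a single one if $Q$ is connected). Let $A=KQ$ be its path algebra. Modules are finite-dimensional right modules. For a module $X$, let $|X|$ be the number of isomorphism classes of indecomposable direct summands of $X$; an $A$-module $X$ is a *tilting module* if $\operatorname{pd} X\le 1$, $\operatorname{Ext}^1_A(X,X)=0$ and $|X|=|A|$. An algebra is *tilted of type $Q$* if it is isomorphic to $\operatorname{End}_A(X)$ for some tilting $A$-module $X$. A *2-term silting complex* over $A$ is a complex $T$ of finitely generated projective $A$-modules, concentrated in degrees $-1$ and $0$, such that $\operatorname{Hom}_{K^b(\operatorname{proj}A)}(T,T[i])=0$ for all $i>0$ and such that the smallest triangulated subcategory of $K^b(\operatorname{proj} A)$ that contains $T$ and is closed under direct summands is $K^b(\operatorname{proj}A)$. For a bounded complex $T$ of finitely generated projective modules put $\tau T=(\nu T)[-1]$, where $\nu=\operatorname{Hom}_K(\operatorname{Hom}_A(-,A),K)$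 is the Nakayama functor, applied in each degree. Let $T$ be a 2-term silting complex over $A$ and suppose that $T\cong M\oplus P[1]$ (that is, there is a quasi-isomorphism from $T$ to $M\oplus P[1]$), where $M$ is an $A$-module and $P$ is a finitely generated projective $A$-module. Write $\operatorname{End}(T)$ for the endomorphism algebra of $T$ in $K^b(\operatorname{proj}A)$. If $P=0$, or if $M$ has no nonzero projective direct summand, then $\operatorname{End}(T)$ is a tilted algebra of type $Q$. More precisely: 1. if $P=0$, then $M$ is a tilting $A$-module and $\operatorname{End}(T)\cong\operatorname{End}_A(M)$ as $K$-algebras; 2. if $M$ has no nonzero projective direct summand, then $\tau T$ belongs to $\operatorname{mod}A$, i.e. there are an $A$-module $X$ and a quasi-isomorphism from $X$ (placed in degree $0$) to $\tau T$; moreover $X$ is a tilting $A$-module and $\operatorname{End}(T)\cong\operatorname{End}_A(X)$ as $K$-algebras. -/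

import Mathlib

universe u

open CategoryTheory CategoryTheory.Limits

noncomputable section

/-! ### Path algebras -/

section PathAlgebra

/-- The paths of a quiver `V`, each recorded with its source and its target. -/
abbrev QuiverPaths (V : Type u) [Quiver.{u} V] : Type u :=
  Σ a : V, Σ b : V, Quiver.Path a b

/-- The path algebra `KV`: the `K`-vector space with basis the paths of the quiver. -/
def PathAlgebra (K : Type u) [Field K] (V : Type u) [Quiver.{u} V] : Type u :=
  QuiverPaths V →₀ K

namespace PathAlgebra

variable (K : Type u) [Field K] (V : Type u) [Quiver.{u} V]

instance : AddCommGroup (PathAlgebra K V) := inferInstanceAs (AddCommGroup (QuiverPaths V →₀ K))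

instance : Module K (PathAlgebra K V) := inferInstanceAs (Module K (QuiverPaths V →₀ K))

variable {V}

/-- The basis element given by a path. -/
def ofPath {a b : V} (p : Quiver.Path a b) : PathAlgebra K V :=
  Finsupp.single (⟨a, b, p⟩ : QuiverPaths V) (1 : K)

instance [Fintype V] : One (PathAlgebra K V) :=
  ⟨∑ v : V, ofPath K (Quiver.Path.nil : Quiver.Path v v)⟩

theorem one_eq [Fintype V] :
    (1 : PathAlgebra K V) = ∑ v : V, ofPath K (Quiver.Path.nil : Quiver.Path v v) := rfl

theorem induction {motive : PathAlgebra K V → Prop} (x : PathAlgebra K V) (zero : motive 0)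
    (add : ∀ x y, motive x → motive y → motive (x + y))
    (smul : ∀ (k : K) {a b : V} (p : Quiver.Path a b), motive (k • ofPath K p)) : motive x := by
  refine Finsupp.induction_linear (motive := motive) x zero add ?_
  rintro ⟨a, b, p⟩ k
  have := smul k p
  unfold ofPath at this
  erw [Finsupp.smul_single, smul_eq_mul, mul_one] at this
  exact this

variable [DecidableEq V]

/-- The product of two basis elements: the concatenation "first `p`, then `q`" if `q` starts where
`p` ends, and zero otherwise. -/
def pathMul (p q : QuiverPaths V) : PathAlgebra K V :=
  if h : p.2.1 = q.1 then ofPath K (p.2.2.comp (q.2.2.cast h.symm rfl)) else 0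

variable (V)

/-- The bilinear extension of the product of paths. -/
def mulLin : PathAlgebra K V →ₗ[K] PathAlgebra K V →ₗ[K] PathAlgebra K V :=
  Finsupp.linearCombination K fun p => Finsupp.linearCombination K fun q => pathMul K p q

instance : Mul (PathAlgebra K V) := ⟨fun x y => mulLin K V x y⟩

variable {V}

theorem mul_eq (x y : PathAlgebra K V) : x * y = mulLin K V x y := rfl

theorem mulLin_ofPath {a b c d : V} (p : Quiver.Path a b) (q : Quiver.Path c d) :
    mulLin K V (ofPath K p) (ofPath K q) = pathMul K ⟨a, b, p⟩ ⟨c, d, q⟩ := by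
  unfold mulLin
  erw [Finsupp.linearCombination_single, one_smul, Finsupp.linearCombination_single, one_smul]

theorem mulLin_ofPath_comp {a b c : V} (p : Quiver.Path a b) (q : Quiver.Path b c) :
    mulLin K V (ofPath K p) (ofPath K q) = ofPath K (p.comp q) := by
  rw [mulLin_ofPath, pathMul, dif_pos rfl]
  rfl

theorem mulLin_ofPath_of_ne {a b c d : V} (p : Quiver.Path a b) (q : Quiver.Path c d)
    (h : b ≠ c) : mulLin K V (ofPath K p) (ofPath K q) = 0 := by
  rw [mulLin_ofPath, pathMul, dif_neg h]

theorem mulLin_assoc (x y z : PathAlgebra K V) :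
    mulLin K V (mulLin K V x y) z = mulLin K V x (mulLin K V y z) := by
  induction x using PathAlgebra.induction with
  | zero => simp
  | add x y hx hy => simp [hx, hy]
  | @smul k a b p =>
  induction y using PathAlgebra.induction with
  | zero => simp
  | add x y hx hy => simp only [map_add, LinearMap.add_apply, hx, hy]
  | @smul l c d q =>
  induction z using PathAlgebra.induction with
  | zero => simp
  | add x y hx hy => simp only [map_add, hx, hy]
  | @smul m e f r =>
  simp only [map_smul, LinearMap.smul_apply]
  congr 3
  by_cases h : b = c
  · subst h
    rw [mulLin_ofPath_comp]
    by_cases h' : d = e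
    · subst h'
      rw [mulLin_ofPath_comp, mulLin_ofPath_comp, mulLin_ofPath_comp, Quiver.Path.comp_assoc]
    · rw [mulLin_ofPath_of_ne K _ _ h', mulLin_ofPath_of_ne K _ _ h', map_zero]
  · rw [mulLin_ofPath_of_ne K _ _ h, map_zero, LinearMap.zero_apply]
    by_cases h' : d = e
    · subst h'
      rw [mulLin_ofPath_comp, mulLin_ofPath_of_ne K _ _ h]
    · rw [mulLin_ofPath_of_ne K _ _ h', map_zero]

theorem mulLin_one [Fintype V] (x : PathAlgebra K V) : mulLin K V x 1 = x := by
  induction x using PathAlgebra.induction with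
  | zero => simp
  | add x y hx hy => simp [hx, hy]
  | @smul k a b p =>
  rw [map_smul, LinearMap.smul_apply, one_eq, map_sum, Finset.sum_eq_single b]
  · rw [mulLin_ofPath_comp, Quiver.Path.comp_nil]
  · intro c _ hc
    exact mulLin_ofPath_of_ne K _ _ hc.symm
  · simp

theorem one_mulLin [Fintype V] (x : PathAlgebra K V) : mulLin K V 1 x = x := by
  induction x using PathAlgebra.induction with
  | zero => simp
  | add x y hx hy => simp [hx, hy]
  | @smul k a b p =>
  rw [map_smul, one_eq, map_sum, LinearMap.sum_apply, Finset.sum_eq_single a]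
  · rw [mulLin_ofPath_comp, Quiver.Path.nil_comp]
  · intro c _ hc
    exact mulLin_ofPath_of_ne K _ _ hc
  · simp

variable (V)

instance [Fintype V] : Ring (PathAlgebra K V) :=
  { (inferInstance : AddCommGroup (PathAlgebra K V)),
    (inferInstance : Mul (PathAlgebra K V)),
    (inferInstance : One (PathAlgebra K V)) with
    left_distrib := fun x y z => by simp [mul_eq]
    right_distrib := fun x y z => by simp [mul_eq]
    zero_mul := fun x => by simp [mul_eq]
    mul_zero := fun x => by simp [mul_eq]
    mul_assoc := mulLin_assoc K
    one_mul := one_mulLin K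
    mul_one := mulLin_one K }

instance [Fintype V] : Algebra K (PathAlgebra K V) :=
  Algebra.ofModule (fun r x y => by simp [mul_eq]) (fun r x y => by simp [mul_eq])

end PathAlgebra

end PathAlgebra

/-! ### Dynkin quivers -/

/-- The simply laced Dynkin diagrams: `A n` is `𝔸ₙ₊₁`, `D n` is `𝔻ₙ₊₄`. -/
inductive DynkinDiagram : Type
  | A (n : ℕ)
  | D (n : ℕ)
  | E₆
  | E₇
  | E₈

/-- The number of vertices of a Dynkin diagram. -/
def DynkinDiagram.rank : DynkinDiagram → ℕ
  | .A n => n + 1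
  | .D n => n + 4
  | .E₆ => 6
  | .E₇ => 7
  | .E₈ => 8

/-- The Cartan matrix of a Dynkin diagram. -/
def DynkinDiagram.cartan : (X : DynkinDiagram) → Matrix (Fin X.rank) (Fin X.rank) ℤ
  | .A n => CartanMatrix.A (n + 1)
  | .D n => CartanMatrix.D (n + 4)
  | .E₆ => CartanMatrix.E₆
  | .E₇ => CartanMatrix.E₇
  | .E₈ => CartanMatrix.E₈

/-- A quiver is Dynkin if it has finitely many arrows and its underlying graph is a finite disjoint
union of simply laced Dynkin diagrams (a single one if the quiver is connected). The underlying
multigraph is recorded by the matrix `2δᵢⱼ - #{arrows i ⟶ j} - #{arrows j ⟶ i}`. -/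
def IsDynkinQuiver (V : Type u) [DecidableEq V] [Quiver.{u} V] : Prop :=
  (∀ i j : V, Finite (i ⟶ j)) ∧
    ∃ (k : ℕ) (X : Fin k → DynkinDiagram) (e : V ≃ Σ s : Fin k, Fin (X s).rank),
      ∀ i j : V, (if i = j then 2 else 0) - (Nat.card (i ⟶ j) : ℤ) - (Nat.card (j ⟶ i) : ℤ) =
        Matrix.blockDiagonal' (fun s => (X s).cartan) (e i) (e j)

/-! ### Modules, tilting modules, tilted algebras -/

/-- The category of right `A`-modules. -/
abbrev RMod (A : Type u) [Ring A] : Type (u + 1) := ModuleCat.{u} Aᵐᵒᵖ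

/-- `M` has no nonzero projective direct summand. -/
def HasNoProjectiveSummand {A : Type u} [Ring A] (M : RMod A) : Prop :=
  ∀ N : RMod A, Nonempty (Retract N M) → Module.Projective Aᵐᵒᵖ N → IsZero N

/-- `|M|`: the number of isomorphism classes of indecomposable direct summands of `M`. -/
def numIndecSummands {A : Type u} [Ring A] (M : RMod A) : ℕ∞ :=
  {c : Quotient (isIsomorphicSetoid (RMod A)) |
    ∃ N : RMod A, Indecomposable N ∧ Nonempty (Retract N M) ∧
      c = Quotient.mk (isIsomorphicSetoid (RMod A)) N}.encard

/-- A finitely generated right `A`-module `M` is a tilting module if it has projective dimension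
at most `1`, `Ext¹(M, M) = 0`, and `|M| = |A|`. -/
structure IsTiltingModule {A : Type u} [Ring A] (M : RMod A) : Prop where
  finite : Module.Finite Aᵐᵒᵖ M
  projDim_le_one : HasProjectiveDimensionLE M 1
  ext_eq_zero : Subsingleton (Abelian.Ext.{u} M M 1)
  card_summands : numIndecSummands M = numIndecSummands (ModuleCat.of Aᵐᵒᵖ A)

/-- A `K`-algebra `B` is tilted of type `V` if it is isomorphic to the endomorphism algebra of a
tilting module over the path algebra of the quiver `V`. -/
def IsTiltedOfType (K : Type u) [Field K] (V : Type u) [Fintype V] [DecidableEq V]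
    [Quiver.{u} V] (B : Type u) [Ring B] [Algebra K B] : Prop :=
  ∃ X : RMod (PathAlgebra K V), IsTiltingModule X ∧ Nonempty (B ≃ₐ[K] End X)

/-! ### Silting complexes -/

/-- Complexes of right `A`-modules, in cohomological grading. -/
abbrev RCpx (A : Type u) [Ring A] : Type (u + 1) := CochainComplex (RMod A) ℤ

/-- The homotopy category of complexes of right `A`-modules. -/
abbrev RK (A : Type u) [Ring A] : Type (u + 1) :=
  HomotopyCategory (RMod A) (ComplexShape.up ℤ)

/-- The class of a complex in the homotopy category. -/
abbrev toK {A : Type u} [Ring A] (T : RCpx A) : RK A :=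
  (HomotopyCategory.quotient (RMod A) (ComplexShape.up ℤ)).obj T

/-- `T` is a bounded complex of finitely generated projective modules. -/
def IsBoundedProj {A : Type u} [Ring A] (T : RCpx A) : Prop :=
  (∀ i : ℤ, Module.Finite Aᵐᵒᵖ (T.X i) ∧ Module.Projective Aᵐᵒᵖ (T.X i)) ∧
    ∃ n : ℤ, ∀ i : ℤ, n < |i| → IsZero (T.X i)

/-- `K^b(proj A)`, as a full subcategory of the homotopy category of all complexes. -/
def KbProj (A : Type u) [Ring A] : ObjectProperty (RK A) :=
  fun X => ∃ T : RCpx A, IsBoundedProj T ∧ Nonempty (X ≅ toK T)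

/-- A complex `T` in `K^b(proj A)` is silting if `Hom(T, T[i]) = 0` for all `i > 0` and `T` generates
`K^b(proj A)`, that is, the smallest triangulated subcategory that is closed under direct summands
and contains `T` is the whole of `K^b(proj A)`. -/
structure IsSilting {A : Type u} [Ring A] (T : RCpx A) : Prop where
  bounded_proj : IsBoundedProj T
  hom_eq_zero : ∀ i : ℤ, 0 < i → ∀ f : toK T ⟶ (toK T)⟦i⟧, f = 0
  generates : KbProj A ≤ (ObjectProperty.singleton (toK T)).triangEnvelope

/-- A silting complex is 2-term if it is concentrated in degrees `-1` and `0`. -/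
structure IsTwoTermSilting {A : Type u} [Ring A] (T : RCpx A) : Prop extends IsSilting T where
  two_term : ∀ i : ℤ, i ≠ -1 → i ≠ 0 → IsZero (T.X i)

/-- The complex `M ⊕ P[1]`: `M` in degree `0`, `P` in degree `-1`, with zero differential. -/
def modulePlusShift {A : Type u} [Ring A] (M P : RMod A) : RCpx A :=
  (HomologicalComplex.single (RMod A) (ComplexShape.up ℤ) 0).obj M ⊞
    (HomologicalComplex.single (RMod A) (ComplexShape.up ℤ) (-1)).obj P

/-! ### The Auslander-Reiten translation -/

section Nakayama

variable (K : Type u) [Field K] {A : Type u} [Ring A] [Algebra K A]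

/-- The underlying space of `D Hom_A(X, A)`, with `D = Hom_K(-, K)`. Here `K` acts on `Hom_A(X, A)`
through its action on the values. -/
def NakayamaObj (X : RMod A) : Type u := (X →ₗ[Aᵐᵒᵖ] A) →ₗ[K] K

namespace NakayamaObj

/-- The left action of `A` on `Hom_A(X, A)`: `(a f)(x) = a f(x)`. -/
def lsmul (X : RMod A) (a : A) : (X →ₗ[Aᵐᵒᵖ] A) →ₗ[K] (X →ₗ[Aᵐᵒᵖ] A) where
  toFun f := a • f
  map_add' f g := smul_add a f g
  map_smul' k f := smul_comm a k f

/-- Precomposition with `g : X → Y`, as a map `Hom_A(Y, A) → Hom_A(X, A)`. -/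
def precomp {X Y : RMod A} (g : X ⟶ Y) : (Y →ₗ[Aᵐᵒᵖ] A) →ₗ[K] (X →ₗ[Aᵐᵒᵖ] A) where
  toFun f := f ∘ₗ g.hom
  map_add' _ _ := rfl
  map_smul' _ _ := rfl

instance (X : RMod A) : AddCommGroup (NakayamaObj K X) :=
  inferInstanceAs (AddCommGroup ((X →ₗ[Aᵐᵒᵖ] A) →ₗ[K] K))

variable {K} in
/-- An element of `D Hom_A(X, A)`, as a linear form on `Hom_A(X, A)`. -/
def toForm {X : RMod A} (φ : NakayamaObj K X) : (X →ₗ[Aᵐᵒᵖ] A) →ₗ[K] K := φ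

/-- The right action of `A` on `D Hom_A(X, A)`: `(φ · a)(f) = φ(a f)`. -/
instance (X : RMod A) : Module Aᵐᵒᵖ (NakayamaObj K X) where
  smul a φ := toForm φ ∘ₗ lsmul K X a.unop
  one_smul φ := LinearMap.ext fun f => congrArg (toForm φ) (one_smul A f)
  mul_smul a b φ := LinearMap.ext fun f => congrArg (toForm φ) (mul_smul b.unop a.unop f)
  smul_zero _ := rfl
  smul_add _ _ _ := rfl
  add_smul a b φ := LinearMap.ext fun f =>
    (congrArg (toForm φ) (add_smul a.unop b.unop f)).trans (map_add (toForm φ) _ _)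
  zero_smul φ := LinearMap.ext fun f =>
    (congrArg (toForm φ) (zero_smul A f)).trans (map_zero (toForm φ))

/-- The map `D Hom_A(X, A) → D Hom_A(Y, A)` induced by `g : X → Y`: `φ ↦ (f ↦ φ (f ∘ g))`. -/
def map {X Y : RMod A} (g : X ⟶ Y) : NakayamaObj K X →ₗ[Aᵐᵒᵖ] NakayamaObj K Y where
  toFun φ := toForm φ ∘ₗ precomp K g
  map_add' _ _ := rfl
  map_smul' _ _ := rfl

end NakayamaObj

variable (A) in
/-- The Nakayama functor `ν = D Hom_A(-, A)` on right `A`-modules. -/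
def nakayama : RMod A ⥤ RMod A where
  obj X := ModuleCat.of Aᵐᵒᵖ (NakayamaObj K X)
  map g := ModuleCat.ofHom (NakayamaObj.map K g)
  map_id _ := rfl
  map_comp _ _ := rfl

instance : (nakayama K A).Additive where
  map_add {X Y f g} := by
    ext φ
    refine LinearMap.ext fun h => ?_
    have : h ∘ₗ (f + g).hom = h ∘ₗ f.hom + h ∘ₗ g.hom := LinearMap.ext fun x => map_add h _ _
    exact (congrArg (NakayamaObj.toForm φ) this).trans (map_add (NakayamaObj.toForm φ) _ _)

/-- The Auslander-Reiten translate `τ T = (ν T)[-1]` of a complex `T` of projective modules, with `ν`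
applied in each degree. -/
def tau (T : RCpx A) : RCpx A :=
  (((nakayama K A).mapHomologicalComplex (ComplexShape.up ℤ)).obj T)⟦(-1 : ℤ)⟧

end Nakayama

end

noncomputable section

/-! ### Vanishing of extension groups -/

namespace ExtVanishing

open Abelian

universe w v u'

variable {C : Type u'} [Category.{v} C] [Abelian C]

/-! Write `T` as `d : T⁻¹ ⟶ T⁰`. If `P = 0`, then `d` is a monomorphism with cokernel `M`, so `T` is
a projective resolution of `M`. If `M` has no projective summand, then `Hom(M, A) = 0`, because the
image of a map to `A` is projective (`A` is hereditary) and would split off `M`. Hence `Hom(d, A)`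
is injective, `ν d` is surjective, and `ν T` is an injective coresolution of `X = ker (ν d)`. This
gives `τ T ≅ X`.

In both cases morphisms of complexes modulo homotopy are the endomorphisms of the resolved module,
for `X` because `ν` is fully faithful on projectives. Rigidity is the condition `Hom(T, T[1]) = 0`,
read through the (co)resolution.

The remaining point is that the module has `|A|` indecomposable summands. Generation by `T` yields a
weaker property, `IsCogenerating`: a finitely generated `N` with `Hom(N, M) = 0 = Ext¹(N, M)` is
zero. Indeed, a resolution of such an `N` is orthogonal to all shifts of `T`, hence to all of
`K^b(proj A)`, hence to itself; for `X` one uses `N[1]` and `ν T`, and concludes from `Hom(N, ν A) =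
0`. The regular module is rigid and cogenerating too, so it suffices that any two rigid cogenerating
modules have equally many summands (`encard_indecSummands_eq`). Their dimension vectors are bases of
the same space: they are independent by the Happel-Ringel lemma and the Euler form
(`linearIndependent_dimVector`), and they span by the dual of Bongartz's completion
(`summandSpan_eq`).

The Dynkin condition enters through `finite_paths`: the underlying graph is a forest, so there are
no oriented cycles and `KQ` is finite dimensional. It is hereditary because its arrow ideal is
projective. -/

theorem shortExact_kernel {X Y : C} (f : X ⟶ Y) [Epi f] :
    (ShortComplex.mk (kernel.ι f) f (kernel.condition f)).ShortExact :=
  { exact := ShortComplex.exact_kernel f }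

theorem shortExact_cokernel {X Y : C} (f : X ⟶ Y) [Mono f] :
    (ShortComplex.mk f (cokernel.π f) (cokernel.condition f)).ShortExact :=
  { exact := ShortComplex.exact_cokernel f }

variable [HasExt.{w} C]

theorem of_retract_right {X Y Z : C} (n : ℕ) (r : Retract Y Z) [Subsingleton (Ext X Z n)] :
    Subsingleton (Ext X Y n) := by
  refine subsingleton_of_forall_eq 0 fun x => ?_
  rw [← x.comp_mk₀_id, ← r.retract, ← Ext.mk₀_comp_mk₀, ← Ext.comp_assoc_of_third_deg_zero,
    Subsingleton.elim (x.comp (Ext.mk₀ r.i) (add_zero n)) 0, Ext.zero_comp]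

theorem of_retract_left {X Y Z : C} (n : ℕ) (r : Retract Y Z) [Subsingleton (Ext Z X n)] :
    Subsingleton (Ext Y X n) := by
  refine subsingleton_of_forall_eq 0 fun x => ?_
  rw [← x.mk₀_id_comp, ← r.retract, ← Ext.mk₀_comp_mk₀, Ext.comp_assoc_of_second_deg_zero,
    Subsingleton.elim ((Ext.mk₀ r.r).comp x (zero_add n)) 0, Ext.comp_zero]

theorem biproduct_right [HasFiniteBiproducts C] {X Y : C} (n k : ℕ) [Subsingleton (Ext X Y n)] :
    Subsingleton (Ext X (⨁ fun _ : Fin k => Y) n) :=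
  (Ext.addEquivBiproduct X (biproduct.isBilimit fun _ : Fin k => Y) n).toEquiv.subsingleton

theorem biproduct_left [HasFiniteBiproducts C] {X Y : C} (n k : ℕ) [Subsingleton (Ext X Y n)] :
    Subsingleton (Ext (⨁ fun _ : Fin k => X) Y n) :=
  (Ext.biproductAddEquiv (biproduct.isBilimit fun _ : Fin k => X) Y n).toEquiv.subsingleton

variable {S : ShortComplex C} (hS : S.ShortExact)

include hS

theorem exists_lift {X : C} [Subsingleton (Ext X S.X₁ 1)] (f : X ⟶ S.X₃) :
    ∃ g : X ⟶ S.X₂, g ≫ S.g = f := by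
  obtain ⟨x, hx⟩ := Ext.covariant_sequence_exact₃ X hS (Ext.mk₀ f) (zero_add 1)
    (Subsingleton.elim _ _)
  obtain ⟨g, rfl⟩ := Ext.mk₀_bijective _ _ |>.2 x
  exact ⟨g, (Ext.mk₀_bijective _ _).1 (by simpa using hx)⟩

theorem exists_desc {Y : C} [Subsingleton (Ext S.X₃ Y 1)] (f : S.X₁ ⟶ Y) :
    ∃ g : S.X₂ ⟶ Y, S.f ≫ g = f := by
  obtain ⟨x, hx⟩ := Ext.contravariant_sequence_exact₁ hS Y (Ext.mk₀ f) (add_zero 1)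
    (Subsingleton.elim _ _)
  obtain ⟨g, rfl⟩ := Ext.mk₀_bijective _ _ |>.2 x
  exact ⟨g, (Ext.mk₀_bijective _ _).1 (by simpa using hx)⟩

theorem right_X₁ {X : C} [Subsingleton (Ext X S.X₂ 1)]
    (h : ∀ f : X ⟶ S.X₃, ∃ g : X ⟶ S.X₂, g ≫ S.g = f) : Subsingleton (Ext X S.X₁ 1) := by
  refine subsingleton_of_forall_eq 0 fun x => ?_
  obtain ⟨y, rfl⟩ := Ext.covariant_sequence_exact₁ X hS x (Subsingleton.elim _ _) (zero_add 1)
  obtain ⟨f, rfl⟩ := Ext.mk₀_bijective _ _ |>.2 y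
  obtain ⟨g, rfl⟩ := h f
  rw [← Ext.mk₀_comp_mk₀, Ext.comp_assoc_of_second_deg_zero, hS.comp_extClass, Ext.comp_zero]

theorem right_X₃ {X : C} (n : ℕ) [Subsingleton (Ext X S.X₂ n)]
    [Subsingleton (Ext X S.X₁ (n + 1))] : Subsingleton (Ext X S.X₃ n) := by
  refine subsingleton_of_forall_eq 0 fun x => ?_
  obtain ⟨y, rfl⟩ := Ext.covariant_sequence_exact₃ X hS x rfl (Subsingleton.elim _ _)
  rw [Subsingleton.elim y 0, Ext.zero_comp]

theorem left_X₃ {Y : C} [Subsingleton (Ext S.X₂ Y 1)]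
    (h : ∀ f : S.X₁ ⟶ Y, ∃ g : S.X₂ ⟶ Y, S.f ≫ g = f) : Subsingleton (Ext S.X₃ Y 1) := by
  refine subsingleton_of_forall_eq 0 fun x => ?_
  obtain ⟨y, rfl⟩ := Ext.contravariant_sequence_exact₃ hS Y x (Subsingleton.elim _ _) (add_zero 1)
  obtain ⟨f, rfl⟩ := Ext.mk₀_bijective _ _ |>.2 y
  obtain ⟨g, rfl⟩ := h f
  rw [← Ext.mk₀_comp_mk₀, ← Ext.comp_assoc _ _ _ (add_zero 1) (zero_add 0) (by omega),
    hS.extClass_comp, Ext.zero_comp]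

theorem left_X₁ {Y : C} (n : ℕ) [Subsingleton (Ext S.X₂ Y n)]
    [Subsingleton (Ext S.X₃ Y (n + 1))] : Subsingleton (Ext S.X₁ Y n) := by
  refine subsingleton_of_forall_eq 0 fun x => ?_
  obtain ⟨y, rfl⟩ := Ext.contravariant_sequence_exact₁ hS Y x (add_comm 1 n)
    (Subsingleton.elim _ _)
  rw [Subsingleton.elim y 0, Ext.comp_zero]

/-- If `Ext¹(S.X₃, S.X₁) = 0`, then `S.X₁` is a direct summand of `S.X₂`. -/
theorem nonempty_retract_X₁ [Subsingleton (Ext S.X₃ S.X₁ 1)] : Nonempty (Retract S.X₁ S.X₂) := by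
  obtain ⟨g, hg⟩ := exists_desc hS (𝟙 S.X₁)
  exact ⟨⟨S.f, g, hg⟩⟩

/-- If `Ext¹(S.X₃, S.X₁) = 0`, then `S.X₃` is a direct summand of `S.X₂`. -/
theorem nonempty_retract_X₃ [Subsingleton (Ext S.X₃ S.X₁ 1)] : Nonempty (Retract S.X₃ S.X₂) := by
  obtain ⟨g, hg⟩ := exists_lift hS (𝟙 S.X₃)
  exact ⟨⟨g, S.g, hg⟩⟩

omit hS

/-- The key step of the Happel-Ringel lemma: the identity of the image of `p ≫ m : X ⟶ Y` is a sum of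
two maps which factor through `X` and through `Y`. -/
theorem exists_add_eq_id {X I Y : C} (p : X ⟶ I) [Epi p] (m : I ⟶ Y) [Mono m]
    [Subsingleton (Ext Y X 1)] [Subsingleton (Ext (cokernel m) (kernel p) 2)] :
    ∃ (a : I ⟶ X) (b : Y ⟶ I), a ≫ p + m ≫ b = 𝟙 I := by
  have hp := shortExact_kernel p
  have hm := shortExact_cokernel m
  -- Vanishing of `Ext²` lifts the class of `m` along `p`. Vanishing of `Ext¹(Y, X)` then makes the
  -- lift the pushout of that class along some `a : I ⟶ X`. So `a ≫ p` and `𝟙 I` have the same image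
  -- under the connecting map, and their difference extends along `m`.
  obtain ⟨e, he⟩ := Ext.covariant_sequence_exact₃ (cokernel m) hp hm.extClass (one_add_one_eq_two)
    (Subsingleton.elim (α := Ext (cokernel m) (kernel p) 2) _ _)
  obtain ⟨x, rfl⟩ := Ext.contravariant_sequence_exact₃ hm X e
    (Subsingleton.elim (α := Ext Y X 1) _ _) (add_zero 1)
  obtain ⟨a, rfl⟩ := Ext.mk₀_bijective _ _ |>.2 x
  obtain ⟨y, hy⟩ := Ext.contravariant_sequence_exact₁ hm I (Ext.mk₀ (𝟙 I - a ≫ p)) (add_zero 1) (by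
    rw [sub_eq_add_neg, Ext.mk₀_add, Ext.mk₀_neg, Ext.comp_add, Ext.comp_neg, Ext.comp_mk₀_id,
      add_neg_eq_zero]
    rw [Ext.comp_assoc_of_third_deg_zero, Ext.mk₀_comp_mk₀] at he
    exact he.symm)
  obtain ⟨b, rfl⟩ := Ext.mk₀_bijective _ _ |>.2 y
  refine ⟨a, b, ?_⟩
  rw [Ext.mk₀_comp_mk₀] at hy
  have := (Ext.mk₀_bijective _ _).1 hy
  change m ≫ b = _ at this
  rw [this]; abel

end ExtVanishing

end

noncomputable section

/-! ### Indecomposable modules over Artinian rings -/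

namespace FiniteModule

variable {R : Type u} [Ring R]

theorem finite_of_epi {X Y : ModuleCat.{u} R} (f : X ⟶ Y) [Epi f] [Module.Finite R X] :
    Module.Finite R Y :=
  Module.Finite.of_surjective f.hom ((ModuleCat.epi_iff_surjective f).1 inferInstance)

theorem finite_of_retract {X Y : ModuleCat.{u} R} (r : Retract X Y) [Module.Finite R Y] :
    Module.Finite R X :=
  finite_of_epi r.r

theorem finite_of_mono [IsNoetherianRing R] {X Y : ModuleCat.{u} R} (f : X ⟶ Y) [Mono f]
    [Module.Finite R Y] : Module.Finite R X :=
  Module.Finite.of_injective f.hom ((ModuleCat.mono_iff_injective f).1 inferInstance)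

instance finite_biprod {X Y : ModuleCat.{u} R} [Module.Finite R X] [Module.Finite R Y] :
    Module.Finite R (X ⊞ Y : ModuleCat.{u} R) :=
  Module.Finite.equiv (ModuleCat.biprodIsoProd X Y).toLinearEquiv.symm

instance finite_biproduct {X : ModuleCat.{u} R} [Module.Finite R X] (k : ℕ) :
    Module.Finite R (⨁ fun _ : Fin k => X : ModuleCat.{u} R) :=
  Module.Finite.equiv (ModuleCat.biproductIsoPi fun _ : Fin k => X).toLinearEquiv.symm

theorem length_lt_of_mono [IsArtinianRing R] {X Y : ModuleCat.{u} R} [Module.Finite R Y]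
    (f : X ⟶ Y) [Mono f] (hf : ¬Epi f) : Module.length R X < Module.length R Y := by
  have : IsNoetherian R Y := isNoetherian_of_isNoetherianRing_of_finite R Y
  have hinj := (ModuleCat.mono_iff_injective f).1 inferInstance
  rw [(LinearEquiv.ofInjective f.hom hinj).length_eq]
  refine Submodule.length_lt fun h => hf ?_
  exact (ModuleCat.epi_iff_surjective f).2 (LinearMap.range_eq_top.1 h)

theorem length_lt_of_epi [IsArtinianRing R] {X Y : ModuleCat.{u} R} [Module.Finite R X]
    (f : X ⟶ Y) [Epi f] (hf : ¬Mono f) : Module.length R Y < Module.length R X := by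
  have : IsNoetherian R X := isNoetherian_of_isNoetherianRing_of_finite R X
  have hsurj := (ModuleCat.epi_iff_surjective f).1 inferInstance
  have := finite_of_epi f
  have : IsNoetherian R Y := isNoetherian_of_isNoetherianRing_of_finite R Y
  rw [Module.length_eq_add_of_exact f.hom.ker.subtype f.hom (Submodule.subtype_injective _) hsurj
    (LinearMap.exact_subtype_ker_map f.hom), add_comm]
  have : Nontrivial f.hom.ker := by
    rw [Submodule.nontrivial_iff_ne_bot]
    exact fun h => hf ((ModuleCat.mono_iff_injective f).2 (LinearMap.ker_eq_bot.1 h))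
  exact (ENat.lt_add_one_iff Module.length_ne_top |>.2 le_rfl).trans_le
    (add_le_add_right (Order.one_le_iff_pos.2 Module.length_pos) _)

/-- Fitting's lemma. -/
theorem isIso_or_isNilpotent [IsArtinianRing R] {X : ModuleCat.{u} R} [Module.Finite R X]
    (hX : Indecomposable X) (f : End X) : IsIso f ∨ IsNilpotent f := by
  have : IsNoetherian R X := isNoetherian_of_isNoetherianRing_of_finite R X
  let g : Module.End R X := ModuleCat.Hom.hom f
  obtain ⟨n, hn, hn1⟩ := ((LinearMap.eventually_isCompl_ker_pow_range_pow g).and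
    (Filter.eventually_ge_atTop 1)).exists
  have hpow : ∀ m, ModuleCat.Hom.hom (f ^ m) = g ^ m := fun m => by
    induction m with
    | zero => rfl
    | succ m ih => rw [pow_succ, pow_succ, ← ih]; rfl
  have e : X ≅ ModuleCat.of R (g ^ n).ker ⊞ ModuleCat.of R (g ^ n).range :=
    (Submodule.prodEquivOfIsCompl _ _ hn).symm.toModuleIso ≪≫ (ModuleCat.biprodIsoProd
      (ModuleCat.of R (g ^ n).ker) (ModuleCat.of R (g ^ n).range)).symm
  rcases hX.2 _ _ e with h | h
  · left
    rw [ModuleCat.isZero_iff_subsingleton] at h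
    have h1 : (g ^ n).ker = ⊥ := (Submodule.subsingleton_iff_eq_bot).1 h
    have h2 : Function.Injective g := by
      refine LinearMap.ker_eq_bot.1 (eq_bot_iff.2 (le_trans ?_ h1.le))
      intro x hx
      obtain ⟨m, rfl⟩ := Nat.exists_eq_add_of_le' hn1
      rw [LinearMap.mem_ker] at hx ⊢
      rw [pow_succ, Module.End.mul_apply, hx, map_zero]
    have h3 := IsArtinian.bijective_of_injective_endomorphism g h2
    exact (ConcreteCategory.isIso_iff_bijective (C := ModuleCat R) f).2 h3
  · right
    refine ⟨n, ?_⟩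
    rw [ModuleCat.isZero_iff_subsingleton] at h
    have h1 : (g ^ n).range = ⊥ := (Submodule.subsingleton_iff_eq_bot).1 h
    apply ModuleCat.hom_ext
    rw [hpow]
    exact LinearMap.range_eq_bot.1 h1

/-- By Fitting's lemma a nonunit is nilpotent, and `1` minus a nilpotent is a unit; so two nonunits
cannot add up to a unit. -/
theorem isLocalRing_end [IsArtinianRing R] {X : ModuleCat.{u} R} [Module.Finite R X]
    (hX : Indecomposable X) : IsLocalRing (End X) := by
  have : Nontrivial (End X) := ⟨⟨0, 1, fun h => hX.1 ((IsZero.iff_id_eq_zero X).2 h.symm)⟩⟩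
  refine IsLocalRing.of_nonunits_add fun a b ha hb hab => ?_
  obtain ⟨c, hc⟩ := hab
  have h1 : ∀ x : End X, x ∈ nonunits (End X) → (↑c⁻¹ * x) ∈ nonunits (End X) := fun x hx h => by
    apply hx
    have := c.isUnit.mul h
    rwa [Units.mul_inv_cancel_left] at this
  have h2 : ↑c⁻¹ * a + ↑c⁻¹ * b = 1 := by rw [← mul_add, ← hc, Units.inv_mul]
  rcases isIso_or_isNilpotent hX (↑c⁻¹ * a) with h | h
  · exact h1 a ha ((isUnit_iff_isIso _).2 h)
  · refine h1 b hb ?_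
    rw [← eq_sub_iff_add_eq'] at h2
    rw [h2]
    exact h.isUnit_one_sub

/-- An indecomposable direct summand of `Y ^ k` is a direct summand of `Y`. -/
theorem nonempty_retract_of_biproduct [IsArtinianRing R] {X Y : ModuleCat.{u} R}
    [Module.Finite R X] (hX : Indecomposable X) {k : ℕ} (r : Retract X (⨁ fun _ : Fin k => Y)) :
    Nonempty (Retract X Y) := by
  have := isLocalRing_end hX
  have h : ∑ j : Fin k, (show End X from
      (r.i ≫ biproduct.π (fun _ : Fin k => Y) j) ≫ (biproduct.ι (fun _ : Fin k => Y) j ≫ r.r)) =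
        1 := by
    have := r.retract
    rw [← Category.id_comp r.r, ← biproduct.total, Preadditive.sum_comp,
      Preadditive.comp_sum] at this
    simpa using this
  obtain ⟨j, -, hj⟩ := IsLocalRing.exists_of_isUnit_sum (h ▸ isUnit_one)
  rw [isUnit_iff_isIso] at hj
  refine ⟨⟨r.i ≫ biproduct.π _ j, (biproduct.ι (fun _ : Fin k => Y) j ≫ r.r) ≫ inv ((r.i ≫ biproduct.π
    (fun _ : Fin k => Y) j) ≫ (biproduct.ι (fun _ : Fin k => Y) j ≫ r.r)), ?_⟩⟩
  rw [← Category.assoc, IsIso.hom_inv_id]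

/-- Transfers nilpotency from `p ≫ a` to `a ≫ p`. -/
theorem end_pow_succ_comp {C : Type*} [Category C] {X I : C} (a : I ⟶ X) (p : X ⟶ I) (n : ℕ) :
    (show End I from a ≫ p) ^ (n + 1) = a ≫ ((show End X from p ≫ a) ^ n : End X) ≫ p := by
  induction n with
  | zero => rw [zero_add, pow_one, pow_zero]; exact congrArg (a ≫ ·) (Category.id_comp p).symm
  | succ n ih =>
    rw [pow_succ, ih, pow_succ]
    simp [End.mul_def]

/-- The Happel-Ringel lemma. -/
theorem mono_or_epi [IsArtinianRing R]
    {X Y : ModuleCat.{u} R} [Module.Finite R X] [Module.Finite R Y] (hX : Indecomposable X)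
    (hY : Indecomposable Y) [Subsingleton (Abelian.Ext.{u} Y X 1)]
    (f : X ⟶ Y) (hf : f ≠ 0)
    [Subsingleton (Abelian.Ext.{u} (cokernel (image.ι f)) (kernel (factorThruImage f)) 2)] :
    Mono f ∨ Epi f := by
  -- If `f` is neither mono nor epi, Fitting's lemma makes both summands of the identity of the
  -- image nilpotent. Then `1` minus a nilpotent is nilpotent, so the image is zero.
  obtain ⟨a, b, hab⟩ := ExtVanishing.exists_add_eq_id (factorThruImage f) (image.ι f)
  rcases isIso_or_isNilpotent hX (factorThruImage f ≫ a) with h | ⟨n, h⟩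
  · left
    have : Mono (factorThruImage f) := mono_of_mono _ a
    rw [← image.fac f]
    infer_instance
  rcases isIso_or_isNilpotent hY (b ≫ image.ι f) with h' | ⟨m, h'⟩
  · right
    have : Epi (image.ι f) := epi_of_epi b _
    rw [← image.fac f]
    infer_instance
  exfalso
  have h1 : IsNilpotent (show End (image f) from a ≫ factorThruImage f) := by
    refine ⟨n + 1, (end_pow_succ_comp _ _ n).trans ?_⟩
    rw [h]; exact (congrArg (a ≫ ·) zero_comp).trans comp_zero
  have h2 : IsNilpotent (show End (image f) from image.ι f ≫ b) := by
    refine ⟨m + 1, (end_pow_succ_comp _ _ m).trans ?_⟩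
    rw [h']; exact (congrArg (image.ι f ≫ ·) zero_comp).trans comp_zero
  have h3 : (show End (image f) from a ≫ factorThruImage f) = 1 - (show End (image f) from image.ι f ≫ b) :=
    eq_sub_of_add_eq hab
  have h4 := h2.isUnit_one_sub
  rw [← h3] at h4
  obtain ⟨k, hk⟩ := h1
  have h5 := h4.pow k
  rw [hk, isUnit_zero_iff] at h5
  apply hf
  rw [← image.fac f, ← Category.id_comp (image.ι f)]
  have h6 : 𝟙 (image f) = 0 := h5.symm
  rw [h6, zero_comp, comp_zero]

end FiniteModule

end

noncomputable section

/-! ### The number of indecomposable summands of a rigid module -/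

namespace FiniteModule

/-! ### Dimension vectors and the Euler form -/

section Dimension

variable (K : Type u) [Field K] {R : Type u} [Ring R] [Algebra K R] [Module.Finite K R]

open ModuleCat in
theorem finite_hom (X Y : ModuleCat.{u} R) [Module.Finite R X] [Module.Finite R Y] :
    Module.Finite K (X ⟶ Y) := by
  have : Module.Finite K X := Module.Finite.trans R X
  have : Module.Finite K Y := Module.Finite.trans R Y
  let φ : (X ⟶ Y) →ₗ[K] (X →ₗ[K] Y) :=
    { toFun := fun f => f.hom.restrictScalars K
      map_add' := fun _ _ => rfl
      map_smul' := fun _ _ => rfl }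
  refine Module.Finite.of_injective φ fun f g h => ?_
  ext x
  exact LinearMap.congr_fun h x

theorem finrank_of_exact {U V W : Type*} [AddCommGroup U] [Module K U] [AddCommGroup V]
    [Module K V] [AddCommGroup W] [Module K W] [Module.Finite K V] (f : U →ₗ[K] V)
    (g : V →ₗ[K] W) (hf : Function.Injective f) (hg : Function.Surjective g)
    (h : Function.Exact f g) :
    Module.finrank K V = Module.finrank K U + Module.finrank K W := by
  rw [← LinearMap.finrank_range_add_finrank_ker g, LinearMap.range_eq_top.2 hg, finrank_top,
    h.linearMap_ker_eq, LinearMap.finrank_range_of_inj hf, add_comm]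

theorem finrank_hom_projective {S : ShortComplex (ModuleCat.{u} R)} (hS : S.ShortExact)
    (P : ModuleCat.{u} R) [Module.Finite R P] [Projective P] [Module.Finite R S.X₂] :
    Module.finrank K (P ⟶ S.X₂) =
      Module.finrank K (P ⟶ S.X₁) + Module.finrank K (P ⟶ S.X₃) := by
  have := finite_hom K P S.X₂
  have := hS.mono_f
  have := hS.epi_g
  refine finrank_of_exact K (Linear.rightComp K P S.f) (Linear.rightComp K P S.g) ?_ ?_ ?_
  · intro a b h
    exact (cancel_mono S.f).1 h
  · intro f
    exact ⟨Projective.factorThru f S.g, Projective.factorThru_comp f S.g⟩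
  · intro f
    refine ⟨fun h => ⟨hS.exact.lift f h, hS.exact.lift_f f h⟩, ?_⟩
    rintro ⟨g, rfl⟩
    change (g ≫ S.f) ≫ S.g = 0
    rw [Category.assoc, S.zero, comp_zero]

theorem finrank_hom_of_ext {S : ShortComplex (ModuleCat.{u} R)} (hS : S.ShortExact)
    (Y : ModuleCat.{u} R) [Module.Finite R Y] [Module.Finite R S.X₂]
    [Subsingleton (Abelian.Ext.{u} S.X₃ Y 1)] :
    Module.finrank K (S.X₂ ⟶ Y) =
      Module.finrank K (S.X₃ ⟶ Y) + Module.finrank K (S.X₁ ⟶ Y) := by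
  have := finite_hom K S.X₂ Y
  have := hS.mono_f
  have := hS.epi_g
  refine finrank_of_exact K (Linear.leftComp K Y S.g) (Linear.leftComp K Y S.f) ?_ ?_ ?_
  · intro a b h
    exact (cancel_epi S.g).1 h
  · intro f
    exact ExtVanishing.exists_desc hS f
  · intro f
    refine ⟨fun h => ⟨hS.exact.desc f h, hS.exact.g_desc f h⟩, ?_⟩
    rintro ⟨g, rfl⟩
    change S.f ≫ S.g ≫ g = 0
    rw [← Category.assoc, S.zero, zero_comp]

open Classical in
/-- The dimension vector of a module `N`: it records the dimension of `Hom(P, N)`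
for all finitely generated projective modules `P`. -/
def dimVector (N P : ModuleCat.{u} R) : ℚ :=
  -- The value `0` elsewhere puts all dimension vectors into one rational vector space, of functions
  -- on all modules, without spoiling additivity.
  if Module.Finite R P ∧ Projective P then Module.finrank K (P ⟶ N) else 0

omit [Module.Finite K R] in
theorem dimVector_apply (N P : ModuleCat.{u} R) [hP : Module.Finite R P] [hP' : Projective P] :
    dimVector K N P = Module.finrank K (P ⟶ N) := if_pos ⟨hP, hP'⟩

theorem dimVector_add {S : ShortComplex (ModuleCat.{u} R)} (hS : S.ShortExact)
    [Module.Finite R S.X₂] : dimVector K S.X₂ = dimVector K S.X₁ + dimVector K S.X₃ := by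
  funext P
  unfold dimVector
  rw [Pi.add_apply]
  split_ifs with h
  · have := h.1
    have := h.2
    exact_mod_cast finrank_hom_projective K hS P
  · simp

omit [Module.Finite K R] in
theorem dimVector_eq_of_iso {X Y : ModuleCat.{u} R} (e : X ≅ Y) :
    dimVector K X = dimVector K Y := by
  funext P
  unfold dimVector
  rw [LinearEquiv.finrank_eq (Linear.homCongr K (Iso.refl P) e)]

theorem dimVector_biprod (X Y : ModuleCat.{u} R) [Module.Finite R X] [Module.Finite R Y] :
    dimVector K (X ⊞ Y) = dimVector K X + dimVector K Y :=
  have : Module.Finite R (ShortComplex.mk (biprod.inl : X ⟶ X ⊞ Y) biprod.snd (by simp)).X₂ :=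
    finite_biprod
  dimVector_add K (ShortComplex.Splitting.ofHasBinaryBiproduct X Y).shortExact

omit [Module.Finite K R] in
theorem dimVector_of_isZero {X : ModuleCat.{u} R} (hX : IsZero X) : dimVector K X = 0 := by
  funext P
  unfold dimVector
  have : Subsingleton (P ⟶ X) := ⟨hX.eq_of_tgt⟩
  rw [Module.finrank_zero_of_subsingleton]
  simp

/-- A finitely generated module has a presentation by a finitely generated projective module. -/
theorem exists_presentation [IsNoetherianRing R] (X : ModuleCat.{u} R) [Module.Finite R X] :
    ∃ (Q : ModuleCat.{u} R) (q : Q ⟶ X), Module.Finite R Q ∧ Projective Q ∧ Epi q := by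
  obtain ⟨n, f, hf⟩ := Module.Finite.exists_fin' R X
  refine ⟨ModuleCat.of R (Fin n → R), ModuleCat.ofHom f, inferInstanceAs (Module.Finite R (Fin n → R)),
    (IsProjective.iff_projective _).1 inferInstance, (ModuleCat.epi_iff_surjective _).2 hf⟩

theorem projective_kernel {X Q : ModuleCat.{u} R} (q : Q ⟶ X) [Projective Q] [Epi q]
    [HasProjectiveDimensionLE X 1] : Projective (kernel q) := by
  rw [projective_iff_hasProjectiveDimensionLT_one]
  exact (ExtVanishing.shortExact_kernel q).hasProjectiveDimensionLT_X₁ 1 inferInstance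
    (by assumption)

/-- The Euler form, as a linear function of the dimension vector of the second argument. -/
theorem exists_euler [IsNoetherianRing R] (X : ModuleCat.{u} R) [Module.Finite R X]
    [HasProjectiveDimensionLE X 1] :
    ∃ φ : (ModuleCat.{u} R → ℚ) →ₗ[ℚ] ℚ, ∀ Y : ModuleCat.{u} R, Module.Finite R Y →
      Subsingleton (Abelian.Ext.{u} X Y 1) → φ (dimVector K Y) = Module.finrank K (X ⟶ Y) := by
  obtain ⟨Q, q, _, _, _⟩ := exists_presentation X
  have := projective_kernel q
  have := finite_of_mono (kernel.ι q)
  -- The resolution `0 → ker q → Q → X → 0` gives `dim Hom(Q, Y) - dim Hom(ker q, Y) = dim Hom(X, Y)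
  -- - dim Ext¹(X, Y)`; the last term vanishes for the `Y` considered.
  refine ⟨LinearMap.proj (R := ℚ) (φ := fun _ : ModuleCat.{u} R => ℚ) Q -
    LinearMap.proj (kernel q), fun Y _ h => ?_⟩
  have : Module.Finite R (ShortComplex.mk (kernel.ι q) q (kernel.condition q)).X₂ := ‹_›
  have h2 := finrank_hom_of_ext K (ExtVanishing.shortExact_kernel q) Y
  rw [LinearMap.sub_apply, LinearMap.proj_apply, LinearMap.proj_apply, dimVector_apply,
    dimVector_apply]
  dsimp only at h2
  rw [h2]
  push_cast
  ring

end Dimension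

/-! ### Isomorphism classes of summands and maps between them -/

section Classes

variable {R : Type u} [Ring R]

/-- The isomorphism classes of indecomposable direct summands of a module. -/
def indecSummands (X : ModuleCat.{u} R) : Set (Quotient (isIsomorphicSetoid (ModuleCat.{u} R))) :=
  {c | ∃ N : ModuleCat.{u} R, Indecomposable N ∧ Nonempty (Retract N X) ∧
    c = Quotient.mk (isIsomorphicSetoid (ModuleCat.{u} R)) N}

theorem indecomposable_of_iso {X Y : ModuleCat.{u} R} (e : X ≅ Y) (hX : Indecomposable X) :
    Indecomposable Y :=
  ⟨fun h => hX.1 (h.of_iso e), fun _ _ e' => hX.2 _ _ (e ≪≫ e')⟩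

theorem out_spec {X : ModuleCat.{u} R} {c : Quotient (isIsomorphicSetoid (ModuleCat.{u} R))}
    (hc : c ∈ indecSummands X) : Indecomposable c.out ∧ Nonempty (Retract c.out X) := by
  obtain ⟨N, h1, ⟨r⟩, rfl⟩ := hc
  obtain ⟨e⟩ : Nonempty ((Quotient.mk (isIsomorphicSetoid (ModuleCat.{u} R)) N).out ≅ N) :=
    Quotient.mk_out (s := isIsomorphicSetoid (ModuleCat.{u} R)) N
  exact ⟨indecomposable_of_iso e.symm h1, ⟨e.retract.trans r⟩⟩

theorem out_iso_mk (N : ModuleCat.{u} R) :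
    Nonempty ((Quotient.mk (isIsomorphicSetoid (ModuleCat.{u} R)) N).out ≅ N) :=
  Quotient.mk_out (s := isIsomorphicSetoid (ModuleCat.{u} R)) N

/-- There are no oriented cycles of nonzero maps between the indecomposable summands of a rigid
module: some summand has no nonzero maps to the others. -/
theorem exists_forall_hom_eq_zero [IsArtinianRing R] {ι : Type*} (t : Finset ι) (ht : t.Nonempty)
    (X : ι → ModuleCat.{u} R) (hfin : ∀ i, Module.Finite R (X i))
    (hpd : ∀ Y : ModuleCat.{u} R, Module.Finite R Y → HasProjectiveDimensionLE Y 1)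
    (hind : ∀ i, Indecomposable (X i))
    (hext : ∀ i j, Subsingleton (Abelian.Ext.{u} (X i) (X j) 1))
    (hiso : ∀ i j, Nonempty (X i ≅ X j) → i = j) :
    ∃ i ∈ t, ∀ j ∈ t, j ≠ i → ∀ f : X i ⟶ X j, f = 0 := by
  classical
  have key : ∀ (i j : ι) (f : X i ⟶ X j), f ≠ 0 → Mono f ∨ Epi f := fun i j f hf => by
    have := hpd _ (finite_of_epi (cokernel.π (image.ι f)))
    have := HasProjectiveDimensionLT.subsingleton.{u} (cokernel (image.ι f)) 2 2 le_rfl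
      (kernel (factorThruImage f))
    exact mono_or_epi (hind i) (hind j) f hf
  have niso : ∀ (i j : ι) (f : X i ⟶ X j), j ≠ i → Mono f → ¬Epi f := fun i j f h h1 h2 => by
    have := isIso_of_mono_of_epi f
    exact h (hiso i j ⟨asIso f⟩).symm
  -- `B` consists of the proper quotients of members of the family. If `B` is empty, nonzero maps
  -- between distinct members are proper monomorphisms, and a member of maximal length has none
  -- going out. Otherwise a member of `B` of minimal length works: a nonzero map out of it, composed
  -- with the proper epimorphism onto it, is not mono, hence epi, so its target would be a shorter
  -- member of `B`.
  let B := t.filter fun j => ∃ k ∈ t, ∃ f : X k ⟶ X j, Epi f ∧ ¬Mono f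
  rcases B.eq_empty_or_nonempty with hB | hB
  · obtain ⟨i, hi, hmax⟩ := t.exists_max_image (fun i => Module.length R (X i)) ht
    refine ⟨i, hi, fun j hj hji f => by_contra fun hf => ?_⟩
    rcases key i j f hf with h | h
    · exact absurd (hmax j hj) (not_le.2 (length_lt_of_mono f (niso i j f hji h)))
    · have : j ∈ B := Finset.mem_filter.2 ⟨hj, i, hi, f, h, fun h' => niso i j f hji h' h⟩
      rw [hB] at this
      exact Finset.notMem_empty _ this
  · obtain ⟨i, hi, hmin⟩ := B.exists_min_image (fun i => Module.length R (X i)) hB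
    obtain ⟨hit, k, hk, g, hg, hg'⟩ := Finset.mem_filter.1 hi
    refine ⟨i, hit, fun j hj hji f => by_contra fun hf => ?_⟩
    have hgf : g ≫ f ≠ 0 := fun h => hf ((cancel_epi g).1 (h.trans comp_zero.symm))
    have hepi : Epi f := by
      rcases key k j _ hgf with h | h
      · exact absurd (mono_of_mono g f) hg'
      · exact epi_of_epi g f
    have hmono : ¬Mono f := fun h => niso i j f hji h hepi
    have : j ∈ B := Finset.mem_filter.2 ⟨hj, i, hit, f, hepi, hmono⟩
    exact absurd (hmin j this) (not_le.2 (length_lt_of_epi f hmono))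

end Classes

section Independence

variable (K : Type u) [Field K] {R : Type u} [Ring R] [Algebra K R] [Module.Finite K R]

/-- The dimension vectors of the indecomposable summands of a rigid module are independent. -/
theorem linearIndependent_dimVector [IsArtinianRing R]
    (hpd : ∀ Y : ModuleCat.{u} R, Module.Finite R Y → HasProjectiveDimensionLE Y 1)
    (X : ModuleCat.{u} R) [Module.Finite R X] [Subsingleton (Abelian.Ext.{u} X X 1)] :
    LinearIndependent ℚ fun c : indecSummands X => dimVector K c.1.out := by
  have hind : ∀ c : indecSummands X, Indecomposable c.1.out := fun c => (out_spec c.2).1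
  have hret : ∀ c : indecSummands X, Nonempty (Retract c.1.out X) := fun c => (out_spec c.2).2
  have hfin : ∀ c : indecSummands X, Module.Finite R c.1.out := fun c =>
    finite_of_retract (hret c).some
  have hext : ∀ c d : indecSummands X, Subsingleton (Abelian.Ext.{u} c.1.out d.1.out 1) :=
    fun c d => by
      have := ExtVanishing.of_retract_left (X := X) 1 (hret c).some
      exact ExtVanishing.of_retract_right 1 (hret d).some
  have hiso : ∀ c d : indecSummands X, Nonempty (c.1.out ≅ d.1.out) → c = d := fun c d h => by
    apply Subtype.ext
    rw [← Quotient.out_eq c.1, ← Quotient.out_eq d.1]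
    exact Quotient.sound (s := isIsomorphicSetoid (ModuleCat.{u} R)) h
  classical
  rw [linearIndependent_iff']
  intro s g hg
  by_contra! hne
  obtain ⟨i₀, hi₀, hi₀'⟩ := hne
  -- Among the summands with nonzero coefficient take one without maps to the others; its Euler form
  -- kills every other term of the relation and leaves its own coefficient times `dim End ≠ 0`.
  obtain ⟨i, hi, hzero⟩ := exists_forall_hom_eq_zero (s.filter fun i => g i ≠ 0)
    ⟨i₀, Finset.mem_filter.2 ⟨hi₀, hi₀'⟩⟩ (fun c => c.1.out) hfin hpd hind hext hiso
  have := hpd _ (hfin i)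
  obtain ⟨φ, hφ⟩ := exists_euler K i.1.out
  have h := congrArg φ hg
  rw [map_sum, map_zero, Finset.sum_eq_single i] at h
  · rw [map_smul, hφ _ (hfin i) (hext i i), smul_eq_mul, mul_eq_zero] at h
    rcases h with h | h
    · exact (Finset.mem_filter.1 hi).2 h
    · have := finite_hom K i.1.out i.1.out
      have : Nontrivial (i.1.out ⟶ i.1.out) :=
        ⟨⟨0, 𝟙 _, fun h => (hind i).1 ((IsZero.iff_id_eq_zero _).2 h.symm)⟩⟩
      exact (Module.finrank_pos (R := K) (M := i.1.out ⟶ i.1.out)).ne' (by exact_mod_cast h)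
  · intro j hj hji
    by_cases hgj : g j = 0
    · rw [hgj, zero_smul, map_zero]
    · have : Subsingleton (i.1.out ⟶ j.1.out) := subsingleton_of_forall_eq 0
        (hzero j (Finset.mem_filter.2 ⟨hj, hgj⟩) hji)
      rw [map_smul, hφ _ (hfin j) (hext i j), Module.finrank_zero_of_subsingleton]
      simp
  · intro h'
    exact absurd (Finset.mem_filter.1 hi).1 h'

end Independence

end FiniteModule

end

noncomputable section

/-! ### The dimension vectors of the summands of a cogenerating rigid module span -/

namespace FiniteModule

variable {R : Type u} [Ring R]

variable (R) in
/-- All finitely generated modules have projective dimension at most one. -/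
def IsHereditary : Prop :=
  ∀ Y : ModuleCat.{u} R, Module.Finite R Y → HasProjectiveDimensionLE Y 1

/-- No nonzero finitely generated module is left orthogonal to `X`. -/
def IsCogenerating (X : ModuleCat.{u} R) : Prop :=
  ∀ N : ModuleCat.{u} R, Module.Finite R N → (∀ f : N ⟶ X, f = 0) →
    Subsingleton (Abelian.Ext.{u} N X 1) → IsZero N

/-- `J` behaves like an injective module with respect to finitely generated modules. -/
def IsExtInjective (J : ModuleCat.{u} R) : Prop :=
  ∀ N : ModuleCat.{u} R, Module.Finite R N → Subsingleton (Abelian.Ext.{u} N J 1)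

theorem IsHereditary.subsingleton (hR : IsHereditary R) (Y Z : ModuleCat.{u} R)
    [Module.Finite R Y] : Subsingleton (Abelian.Ext.{u} Y Z 2) :=
  have := hR Y inferInstance
  HasProjectiveDimensionLT.subsingleton.{u} Y 2 2 le_rfl Z

variable (K : Type u) [Field K] [Algebra K R] [Module.Finite K R]

include K

/-- Finitely generated left approximations. -/
theorem exists_approximation (E X : ModuleCat.{u} R) [Module.Finite R E] [Module.Finite R X] :
    ∃ (k : ℕ) (u : E ⟶ ⨁ fun _ : Fin k => X), ∀ f : E ⟶ X, ∃ g, u ≫ g = f := by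
  have := finite_hom K E X
  let b := Module.finBasis K (E ⟶ X)
  refine ⟨_, biproduct.lift b, fun f => ⟨biproduct.desc fun i => b.repr f i • 𝟙 X, ?_⟩⟩
  rw [biproduct.lift_desc]
  simp [b.sum_repr f]

/-- The kernel of a left approximation `u` of `E` is orthogonal to `X`, hence zero. Its `Ext¹` to
`X` vanishes by heredity, as it does for `E`. Since `Ext¹(image u, X) = 0`, a map from the kernel to
`X` extends to `E`; it then factors through `u`, which kills the kernel. -/
theorem exists_mono_biproduct [IsNoetherianRing R] (hR : IsHereditary R) (E X : ModuleCat.{u} R)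
    [Module.Finite R E] [Module.Finite R X] [Subsingleton (Abelian.Ext.{u} X X 1)]
    (hX : IsCogenerating X) [Subsingleton (Abelian.Ext.{u} E X 1)] :
    ∃ (k : ℕ) (u : E ⟶ ⨁ fun _ : Fin k => X), Mono u ∧ ∀ f : E ⟶ X, ∃ g, u ≫ g = f := by
  obtain ⟨k, u, hu⟩ := exists_approximation K E X
  refine ⟨k, u, ?_, hu⟩
  have hker := ExtVanishing.shortExact_kernel (factorThruImage u)
  have hcok := ExtVanishing.shortExact_cokernel (image.ι u)
  have h1 : Subsingleton (Abelian.Ext.{u} (⨁ fun _ : Fin k => X) X 1) :=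
    ExtVanishing.biproduct_left 1 k
  have := finite_of_epi (cokernel.π (image.ι u))
  have := finite_of_mono (image.ι u)
  have := finite_of_mono (kernel.ι (factorThruImage u))
  have h2 := hR.subsingleton (cokernel (image.ι u)) X
  have h3 : Subsingleton (Abelian.Ext.{u} (image u) X 1) :=
    @ExtVanishing.left_X₁ _ _ _ _ _ hcok X 1 h1 h2
  have h4 := hR.subsingleton (image u) X
  have h5 : Subsingleton (Abelian.Ext.{u} (kernel (factorThruImage u)) X 1) :=
    @ExtVanishing.left_X₁ _ _ _ _ _ hker X 1 ‹_› h4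
  have h6 : IsZero (kernel (factorThruImage u)) := by
    refine hX _ inferInstance (fun f => ?_) h5
    obtain ⟨g, hg⟩ := @ExtVanishing.exists_desc _ _ _ _ _ hker X h3 f
    obtain ⟨h, rfl⟩ := hu g
    have h7 : u ≫ h = factorThruImage u ≫ image.ι u ≫ h := by
      rw [← Category.assoc, image.fac]
    rw [← hg, h7]
    exact kernel.condition_assoc (factorThruImage u) (image.ι u ≫ h) |>.trans zero_comp
  have : Mono (factorThruImage u) := Preadditive.mono_of_isZero_kernel _ h6
  rw [← image.fac u]
  infer_instance

/-- Approximate twice. In `0 → E → X^k → C → 0` the cokernel again satisfies `Ext¹(C, X) = 0`, so it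
embeds into some `X^l`. By heredity `Ext¹(X^l, E) = 0` forces `Ext¹(C, E) = 0`, and the sequence
splits. -/
theorem exists_retract_biproduct [IsNoetherianRing R] (hR : IsHereditary R)
    (E X : ModuleCat.{u} R) [Module.Finite R E] [Module.Finite R X]
    [Subsingleton (Abelian.Ext.{u} X X 1)] (hX : IsCogenerating X)
    [Subsingleton (Abelian.Ext.{u} E X 1)] [Subsingleton (Abelian.Ext.{u} X E 1)] :
    ∃ k : ℕ, Nonempty (Retract E (⨁ fun _ : Fin k => X)) := by
  obtain ⟨k, u, hu, hu'⟩ := exists_mono_biproduct K hR E X hX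
  have hS := ExtVanishing.shortExact_cokernel u
  have h1 : Subsingleton (Abelian.Ext.{u} (⨁ fun _ : Fin k => X) X 1) :=
    ExtVanishing.biproduct_left 1 k
  have h2 : Subsingleton (Abelian.Ext.{u} (cokernel u) X 1) :=
    @ExtVanishing.left_X₃ _ _ _ _ _ hS X h1 hu'
  have := finite_of_epi (cokernel.π u)
  obtain ⟨l, v, hv, -⟩ := exists_mono_biproduct K hR (cokernel u) X hX
  have hS' := ExtVanishing.shortExact_cokernel v
  have := finite_of_epi (cokernel.π v)
  have h3 : Subsingleton (Abelian.Ext.{u} (⨁ fun _ : Fin l => X) E 1) :=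
    ExtVanishing.biproduct_left 1 l
  have h4 := hR.subsingleton (cokernel v) E
  have h5 : Subsingleton (Abelian.Ext.{u} (cokernel u) E 1) :=
    @ExtVanishing.left_X₁ _ _ _ _ _ hS' E 1 h3 h4
  exact ⟨k, @ExtVanishing.nonempty_retract_X₁ _ _ _ _ _ hS h5⟩

/-- The span of the dimension vectors of the indecomposable summands of `X`. -/
def summandSpan (X : ModuleCat.{u} R) : Submodule ℚ (ModuleCat.{u} R → ℚ) :=
  Submodule.span ℚ (Set.range fun c : indecSummands X => dimVector K c.1.out)

/-- Split off summands, by induction on the length `n`, until they are indecomposable; an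
indecomposable summand of `X^k` is one of `X` because its endomorphism ring is local. -/
theorem dimVector_mem_of_retract [IsArtinianRing R] (X : ModuleCat.{u} R) {k : ℕ}
    (n : ℕ) : ∀ (Y : ModuleCat.{u} R), Module.Finite R Y → Module.length R Y ≤ n →
      Retract Y (⨁ fun _ : Fin k => X) → dimVector K Y ∈ summandSpan K X := by
  induction n with
  | zero =>
    intro Y _ hY _
    have : Subsingleton Y := by
      rwa [Nat.cast_zero, nonpos_iff_eq_zero, Module.length_eq_zero_iff] at hY
    rw [dimVector_of_isZero K (ModuleCat.isZero_of_subsingleton Y)]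
    exact Submodule.zero_mem _
  | succ n ih =>
    intro Y _ hY r
    by_cases h0 : IsZero Y
    · rw [dimVector_of_isZero K h0]
      exact Submodule.zero_mem _
    by_cases hind : Indecomposable Y
    · obtain ⟨r'⟩ := nonempty_retract_of_biproduct hind r
      refine Submodule.subset_span
        ⟨⟨Quotient.mk (isIsomorphicSetoid (ModuleCat.{u} R)) Y, Y, hind, ⟨r'⟩, rfl⟩, ?_⟩
      obtain ⟨e⟩ := out_iso_mk Y
      exact dimVector_eq_of_iso K e
    · have : ∃ (A B : ModuleCat.{u} R) (_ : Y ≅ A ⊞ B), ¬IsZero A ∧ ¬IsZero B := by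
        by_contra! h
        exact hind ⟨h0, fun A B e => or_iff_not_imp_left.2 (h A B e)⟩
      obtain ⟨A, B, e, hA, hB⟩ := this
      have rA : Retract A Y := Retract.trans ⟨biprod.inl, biprod.fst, by simp⟩ e.symm.retract
      have rB : Retract B Y := Retract.trans ⟨biprod.inr, biprod.snd, by simp⟩ e.symm.retract
      have := finite_of_retract rA
      have := finite_of_retract rB
      have : IsNoetherian R A := isNoetherian_of_isNoetherianRing_of_finite R A
      have : IsNoetherian R B := isNoetherian_of_isNoetherianRing_of_finite R B
      rw [ModuleCat.isZero_iff_subsingleton, not_subsingleton_iff_nontrivial] at hA hB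
      have hlen : Module.length R A + Module.length R B ≤ n + 1 := by
        rw [← Module.length_prod]
        refine le_trans (le_of_eq ?_) hY
        exact ((e ≪≫ ModuleCat.biprodIsoProd A B).toLinearEquiv.length_eq).symm
      have h1 : Module.length R A ≠ ⊤ := Module.length_ne_top
      have h2 : Module.length R B ≠ ⊤ := Module.length_ne_top
      have h3 : 0 < Module.length R A := Module.length_pos
      have h4 : 0 < Module.length R B := Module.length_pos
      rw [dimVector_eq_of_iso K e, dimVector_biprod]
      lift Module.length R A to ℕ using h1 with a ha
      lift Module.length R B to ℕ using h2 with b hb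
      norm_cast at hlen h3 h4
      refine Submodule.add_mem _ (ih A inferInstance ?_ (rA.trans r))
        (ih B inferInstance ?_ (rB.trans r))
      · rw [← ha]; norm_cast; omega
      · rw [← hb]; norm_cast; omega

theorem dimVector_mem [IsArtinianRing R] (X : ModuleCat.{u} R) {k : ℕ} (Y : ModuleCat.{u} R)
    [Module.Finite R Y] (r : Retract Y (⨁ fun _ : Fin k => X)) :
    dimVector K Y ∈ summandSpan K X := by
  have : IsNoetherian R Y := isNoetherian_of_isNoetherianRing_of_finite R Y
  obtain ⟨n, hn⟩ := ENat.ne_top_iff_exists.1 (Module.length_ne_top (R := R) (M := Y))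
  exact dimVector_mem_of_retract K X n Y inferInstance hn.symm.le r

/-- The dual of Bongartz's construction of a complement. -/
theorem dimVector_mem_of_extInjective [IsArtinianRing R] (hR : IsHereditary R)
    (X J : ModuleCat.{u} R) [Module.Finite R X] [Module.Finite R J]
    [Subsingleton (Abelian.Ext.{u} X X 1)] (hX : IsCogenerating X) (hJ : IsExtInjective J) :
    dimVector K J ∈ summandSpan K X := by
  obtain ⟨Q, q, _, _, _⟩ := exists_presentation J
  have := hR J inferInstance
  have := projective_kernel q
  have := finite_of_mono (kernel.ι q)
  have hJS := ExtVanishing.shortExact_kernel q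
  obtain ⟨k, u, hu⟩ := exists_approximation K (kernel q) X
  -- The cokernel of `m` is, up to a sign, the pushout of `u` and `kernel.ι q`, that is, the middle
  -- term of an extension of `J` by `X^k`. It will be a summand of a power of `X`.
  let m : kernel q ⟶ (⨁ fun _ : Fin k => X) ⊞ Q := biprod.lift u (kernel.ι q)
  have : Mono m := by
    have : Mono (m ≫ biprod.snd) := by rw [biprod.lift_snd]; infer_instance
    exact mono_of_mono m biprod.snd
  have hS := ExtVanishing.shortExact_cokernel m
  have := finite_of_epi (cokernel.π m)
  have h1 : Subsingleton (Abelian.Ext.{u} (⨁ fun _ : Fin k => X) X 1) :=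
    ExtVanishing.biproduct_left 1 k
  have h1' : Subsingleton (Abelian.Ext.{u} X (⨁ fun _ : Fin k => X) 1) :=
    ExtVanishing.biproduct_right 1 k
  have h2 : Subsingleton (Abelian.Ext.{u} Q X 1) :=
    HasProjectiveDimensionLT.subsingleton.{u} Q 1 1 le_rfl X
  have h3 : Subsingleton (Abelian.Ext.{u} ((⨁ fun _ : Fin k => X) ⊞ Q) X 1) :=
    (Abelian.Ext.biprodAddEquiv).toEquiv.subsingleton
  have h4 : Subsingleton (Abelian.Ext.{u} (cokernel m) X 1) := by
    refine @ExtVanishing.left_X₃ _ _ _ _ _ hS X h3 fun f => ?_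
    obtain ⟨g, rfl⟩ := hu f
    exact ⟨biprod.fst ≫ g, by simp [m]⟩
  -- A class lifts to `Ext¹(X, X^k ⊞ Q)` by heredity. Its first component vanishes by rigidity, and
  -- its second comes from `ker q` since `Ext¹(X, J) = 0`. So the lift comes from `m`, and it dies
  -- in the cokernel.
  have h5 : Subsingleton (Abelian.Ext.{u} X (cokernel m) 1) := by
    refine subsingleton_of_forall_eq 0 fun x => ?_
    obtain ⟨y, rfl⟩ := Abelian.Ext.covariant_sequence_exact₃ X hS x (one_add_one_eq_two)
      (@Subsingleton.elim _ (hR.subsingleton X (kernel q)) _ _)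
    obtain ⟨z, hz⟩ := Abelian.Ext.covariant_sequence_exact₂ X hJS
      (y.comp (Abelian.Ext.mk₀ biprod.snd) (add_zero 1))
      (@Subsingleton.elim _ (hJ X inferInstance) _ _)
    have hy : y = z.comp (Abelian.Ext.mk₀ m) (add_zero 1) := by
      refine Abelian.Ext.addEquivBiprod.injective (Prod.ext (Subsingleton.elim _ _) ?_)
      rw [Abelian.Ext.addEquivBiprod_apply_snd, Abelian.Ext.addEquivBiprod_apply_snd, ← hz]
      rw [Abelian.Ext.comp_assoc_of_second_deg_zero, Abelian.Ext.mk₀_comp_mk₀]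
      simp [m]
    rw [hy, Abelian.Ext.comp_assoc_of_second_deg_zero, Abelian.Ext.mk₀_comp_mk₀]
    simp
  obtain ⟨l, ⟨r⟩⟩ := exists_retract_biproduct K hR (cokernel m) X hX
  have e1 := @dimVector_add K _ R _ _ _ _ hS finite_biprod
  have e2 := @dimVector_add K _ R _ _ _ _ hJS ‹_›
  dsimp only at e1 e2
  rw [dimVector_biprod] at e1
  have e3 : dimVector K J = dimVector K (cokernel m) - dimVector K (⨁ fun _ : Fin k => X) := by
    rw [e2] at e1
    have : dimVector K (⨁ fun _ : Fin k => X) + dimVector K J = dimVector K (cokernel m) := by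
      apply add_left_cancel (a := dimVector K (kernel q))
      rw [← e1]; abel
    rw [← this]; abel
  rw [e3]
  exact Submodule.sub_mem _ (dimVector_mem K X _ r) (dimVector_mem K X _ (Retract.refl _))

/-- The span of all dimension vectors of finitely generated modules. -/
def dimSpan : Submodule ℚ (ModuleCat.{u} R → ℚ) :=
  Submodule.span ℚ {v | ∃ N : ModuleCat.{u} R, Module.Finite R N ∧ dimVector K N = v}

/-- Embed `N` into an injective-like `J`. By heredity `J / N` is again of this kind, so the vector
of `N` is a difference of two vectors covered by Bongartz's construction. -/
theorem summandSpan_eq [IsArtinianRing R] (hR : IsHereditary R)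
    (hJ : ∀ N : ModuleCat.{u} R, Module.Finite R N → ∃ (J : ModuleCat.{u} R) (i : N ⟶ J),
      Module.Finite R J ∧ Mono i ∧ IsExtInjective J)
    (X : ModuleCat.{u} R) [Module.Finite R X] [Subsingleton (Abelian.Ext.{u} X X 1)]
    (hX : IsCogenerating X) : summandSpan K X = dimSpan (R := R) K := by
  refine le_antisymm (Submodule.span_le.2 ?_) (Submodule.span_le.2 ?_)
  · rintro _ ⟨c, rfl⟩
    exact Submodule.subset_span ⟨c.1.out, finite_of_retract (out_spec c.2).2.some, rfl⟩
  · rintro _ ⟨N, _, rfl⟩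
    obtain ⟨J, i, _, _, hJ'⟩ := hJ N inferInstance
    have hS := ExtVanishing.shortExact_cokernel i
    have := finite_of_epi (cokernel.π i)
    have h1 : IsExtInjective (cokernel i) := fun Y _ => by
      exact @ExtVanishing.right_X₃ _ _ _ _ _ hS Y 1 (hJ' Y inferInstance) (hR.subsingleton Y N)
    have e := @dimVector_add K _ R _ _ _ _ hS ‹_›
    dsimp only at e
    rw [eq_sub_of_add_eq e.symm]
    exact Submodule.sub_mem _ (dimVector_mem_of_extInjective K hR X J hX hJ')
      (dimVector_mem_of_extInjective K hR X (cokernel i) hX h1)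

/-- Two rigid cogenerating modules have the same number of indecomposable summands. -/
theorem encard_indecSummands_eq [IsArtinianRing R] (hR : IsHereditary R)
    (hJ : ∀ N : ModuleCat.{u} R, Module.Finite R N → ∃ (J : ModuleCat.{u} R) (i : N ⟶ J),
      Module.Finite R J ∧ Mono i ∧ IsExtInjective J)
    (X Y : ModuleCat.{u} R) [Module.Finite R X] [Subsingleton (Abelian.Ext.{u} X X 1)]
    (hX : IsCogenerating X) [Module.Finite R Y] [Subsingleton (Abelian.Ext.{u} Y Y 1)]
    (hY : IsCogenerating Y) : (indecSummands X).encard = (indecSummands Y).encard := by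
  have bX := Module.Basis.span (linearIndependent_dimVector K hR X)
  have bY := Module.Basis.span (linearIndependent_dimVector K hR Y)
  have h : summandSpan K X = summandSpan K Y :=
    (summandSpan_eq K hR hJ X hX).trans (summandSpan_eq K hR hJ Y hY).symm
  exact Set.encard_congr (bX.indexEquiv (bY.map (LinearEquiv.ofEq _ _ h.symm)))

end FiniteModule

end

noncomputable section

/-! ### Orthogonality in triangulated categories -/

namespace TriangulatedOrthogonality

variable {C D : Type*} [Category C] [Category D]

theorem isStableUnderRetracts_rightOrthogonal [HasZeroMorphisms D]
    (P : ObjectProperty D) :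
    P.rightOrthogonal.IsStableUnderRetracts where
  of_retract r hY X f hX := by
    rw [← Category.comp_id f, ← r.retract, ← Category.assoc, hY (f ≫ r.i) hX, zero_comp]

section

variable [HasShift D ℤ] [Preadditive D] [∀ n : ℤ, (shiftFunctor D n).Additive]

theorem rightOrthogonal_shiftClosure_iff (U Z : D) :
    ((ObjectProperty.singleton U).shiftClosure ℤ).rightOrthogonal Z ↔
      ∀ (n : ℤ) (f : U ⟶ Z⟦n⟧), f = 0 := by
  constructor
  · intro h n f
    have h1 : ((ObjectProperty.singleton U).shiftClosure ℤ).rightOrthogonal (Z⟦n⟧) :=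
      ObjectProperty.le_shift _ n _ h
    exact h1 f (ObjectProperty.le_shiftClosure _ _ (by simp))
  · rintro h X f ⟨Y, n, e, hY⟩
    obtain rfl : U = Y := by simpa using hY
    have h1 : (shiftShiftNeg U n).inv ≫ (e.inv ≫ f)⟦-n⟧' = 0 := h _ _
    rw [Preadditive.IsIso.comp_left_eq_zero] at h1
    have h2 : e.inv ≫ f = 0 := (shiftFunctor D (-n)).map_injective (by rw [h1, Functor.map_zero])
    rwa [Preadditive.IsIso.comp_left_eq_zero] at h2

end

variable [HasZeroObject C] [HasShift C ℤ]
  [Preadditive C] [∀ n : ℤ, (shiftFunctor C n).Additive] [Pretriangulated C]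
  [HasZeroObject D] [HasShift D ℤ] [Preadditive D] [∀ n : ℤ, (shiftFunctor D n).Additive]
  [Pretriangulated D]

/-- If `F T` is right orthogonal to all shifts of `U`, then so is `F Z` for each `Z` which is
generated by `T`. -/
theorem hom_eq_zero_of_triangEnvelope (F : C ⥤ D) [F.CommShift ℤ] [F.IsTriangulated] {T Z : C}
    {U : D} (h : ∀ (n : ℤ) (f : U ⟶ (F.obj T)⟦n⟧), f = 0)
    (hZ : (ObjectProperty.singleton T).triangEnvelope Z) (n : ℤ) (f : U ⟶ (F.obj Z)⟦n⟧) :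
    f = 0 := by
  -- The right orthogonal of all shifts of `U` is triangulated and closed under retracts, and so is
  -- its preimage under `F`; it contains `T`, hence everything `T` generates.
  let P := ((ObjectProperty.singleton U).shiftClosure ℤ).rightOrthogonal
  have : P.IsStableUnderRetracts := isStableUnderRetracts_rightOrthogonal _
  have : (P.inverseImage F).IsStableUnderRetracts :=
    ⟨fun r hY => P.prop_of_retract (r.map F) hY⟩
  have h1 : ObjectProperty.singleton T ≤ P.inverseImage F := by
    intro X hX
    obtain rfl : T = X := by simpa using hX
    exact (rightOrthogonal_shiftClosure_iff U (F.obj T)).2 h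
  exact (rightOrthogonal_shiftClosure_iff U (F.obj Z)).1
    (((ObjectProperty.singleton _).triangEnvelope_le_iff.2 h1) Z hZ) n f

end TriangulatedOrthogonality

/-! ### Complexes concentrated in degrees `-1` and `0` -/

namespace TwoTerm

open CochainComplex.HomComplex

variable {C : Type*} [Category C] [Preadditive C]

/-- The complex `U` is concentrated in degrees `-1` and `0`. -/
def IsTwoTerm (U : CochainComplex C ℤ) : Prop :=
  ∀ i : ℤ, i ≠ -1 → i ≠ 0 → IsZero (U.X i)

/-- The class of a complex in the homotopy category. -/
abbrev toHo (U : CochainComplex C ℤ) : HomotopyCategory C (ComplexShape.up ℤ) :=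
  (HomotopyCategory.quotient C (ComplexShape.up ℤ)).obj U

theorem forall_hom_eq_zero_iff (U Z : CochainComplex C ℤ) (n : ℤ) :
    (∀ f : toHo U ⟶ (toHo Z)⟦n⟧, f = 0) ↔
      ∀ z : Cocycle U Z n, z ∈ coboundaries U Z n := by
  let e : toHo (Z⟦n⟧) ≅ (toHo Z)⟦n⟧ :=
    ((HomotopyCategory.quotient C (ComplexShape.up ℤ)).commShiftIso n).app Z
  constructor
  · intro h z
    rw [← CohomologyClass.toHom_mk_eq_zero_iff]
    have := h (CohomologyClass.toHom (CohomologyClass.mk z) ≫ e.hom)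
    rwa [Preadditive.IsIso.comp_right_eq_zero] at this
  · intro h f
    obtain ⟨c, hc⟩ := (CohomologyClass.toHom_bijective U Z n).2 (f ≫ e.inv)
    obtain ⟨z, rfl⟩ := c.mk_surjective
    rw [(CohomologyClass.toHom_mk_eq_zero_iff z).2 (h z)] at hc
    have := hc.symm
    rwa [Preadditive.IsIso.comp_right_eq_zero] at this

variable {U Z : CochainComplex C ℤ}

/-- A cochain of degree `1` has a single component `U⁻¹ ⟶ Z⁰` and is automatically a cocycle, so the
condition says that it is a coboundary. -/
theorem hom_shift_one_eq_zero_iff (hU : IsTwoTerm U) (hZ : IsTwoTerm Z) :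
    (∀ f : toHo U ⟶ (toHo Z)⟦(1 : ℤ)⟧, f = 0) ↔
      ∀ h : U.X (-1) ⟶ Z.X 0, ∃ (a : U.X (-1) ⟶ Z.X (-1)) (b : U.X 0 ⟶ Z.X 0),
        h = a ≫ Z.d (-1) 0 + U.d (-1) 0 ≫ b := by
  rw [forall_hom_eq_zero_iff]
  constructor
  · intro H h
    have hcoc : δ 1 2 (Cochain.single h 1) = 0 := by
      ext p q hpq
      rw [δ_v 1 2 rfl _ p q hpq (q - 1) (p + 1) rfl rfl]
      by_cases hp : p = -1
      · subst hp
        exact (hZ q (by omega) (by omega)).eq_of_tgt _ _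
      · by_cases hp' : p = 0
        · subst hp'
          exact (hZ q (by omega) (by omega)).eq_of_tgt _ _
        · exact (hU p hp hp').eq_of_src _ _
    obtain ⟨β, hβ⟩ := (mem_coboundaries_iff (n := 1) _ 0 (zero_add 1)).1 (H (Cocycle.mk _ 2 rfl hcoc))
    have h1 := Cochain.congr_v hβ (-1) 0 rfl
    rw [δ_v 0 1 rfl _ (-1) 0 rfl (-1) 0 rfl rfl] at h1
    -- The differential of a cochain of degree `0` carries a minus sign on the second term; it is
    -- absorbed into `b`.
    refine ⟨β.v (-1) (-1) rfl, -β.v 0 0 rfl, ?_⟩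
    have h2 : (Cochain.single h 1).v (-1) 0 rfl = h := Cochain.single_v h 1 rfl
    rw [← h2]
    refine h1.symm.trans ?_
    simp
  · intro H z
    obtain ⟨a, b, hab⟩ := H (z.1.v (-1) 0 rfl)
    refine (mem_coboundaries_iff (n := 1) _ 0 (zero_add 1)).2 ⟨Cochain.single a 0 - Cochain.single b 0, ?_⟩
    ext p q hpq
    by_cases hp : p = -1
    · subst hp
      obtain rfl : q = 0 := by omega
      rw [δ_v 0 1 rfl _ (-1) 0 rfl (-1) 0 rfl rfl]
      refine Eq.trans ?_ hab.symm
      simp [Cochain.single_v, Cochain.single_v_eq_zero]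
    · by_cases hp' : p = 0
      · subst hp'
        exact (hZ q (by omega) (by omega)).eq_of_tgt _ _
      · exact (hU p hp hp').eq_of_src _ _

theorem quotient_map_eq_zero_iff (hU : IsTwoTerm U) (hZ : IsTwoTerm Z) (φ : U ⟶ Z) :
    (HomotopyCategory.quotient C (ComplexShape.up ℤ)).map φ = 0 ↔
      ∃ s : U.X 0 ⟶ Z.X (-1), φ.f (-1) = U.d (-1) 0 ≫ s ∧ φ.f 0 = s ≫ Z.d (-1) 0 := by
  rw [HomotopyCategory.quotient_map_eq_zero_iff]
  constructor
  · rintro ⟨h⟩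
    refine ⟨h.hom 0 (-1), ?_, ?_⟩
    · have := h.comm (-1)
      rw [dNext_eq _ (show (ComplexShape.up ℤ).Rel (-1) 0 from rfl),
        prevD_eq _ (show (ComplexShape.up ℤ).Rel (-2) (-1) from rfl),
        (hZ (-2) (by omega) (by omega)).eq_of_tgt (h.hom (-1) (-2)) 0] at this
      simpa using this
    · have := h.comm 0
      rw [dNext_eq _ (show (ComplexShape.up ℤ).Rel 0 1 from rfl),
        prevD_eq _ (show (ComplexShape.up ℤ).Rel (-1) 0 from rfl),
        (hU 1 (by omega) (by omega)).eq_of_src (h.hom 1 0) 0] at this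
      simpa using this
  · rintro ⟨s, h1, h0⟩
    refine ⟨(Cochain.equivHomotopy φ 0).symm ⟨Cochain.single s (-1), ?_⟩⟩
    ext p
    rw [Cochain.ofHom_zero, add_zero, Cochain.ofHom_v]
    by_cases hp : p = -1
    · subst hp
      rw [δ_v (-1) 0 rfl _ (-1) (-1) rfl (-2) 0 rfl rfl, Cochain.single_v,
        Cochain.single_v_eq_zero _ _ _ _ _ (by omega), h1]
      simp
    · by_cases hp' : p = 0
      · subst hp'
        rw [δ_v (-1) 0 rfl _ 0 0 rfl (-1) 1 rfl rfl, Cochain.single_v,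
          Cochain.single_v_eq_zero _ _ _ _ _ (by omega), h0]
        simp
      · exact (hU p hp hp').eq_of_src _ _

/-- A morphism of complexes which are concentrated in degrees `-1` and `0`. -/
theorem exists_hom (hU : IsTwoTerm U) (hZ : IsTwoTerm Z) (f₁ : U.X (-1) ⟶ Z.X (-1))
    (f₀ : U.X 0 ⟶ Z.X 0) (h : f₁ ≫ Z.d (-1) 0 = U.d (-1) 0 ≫ f₀) :
    ∃ φ : U ⟶ Z, φ.f (-1) = f₁ ∧ φ.f 0 = f₀ := by
  let z : Cochain U Z 0 := Cochain.single f₁ 0 + Cochain.single f₀ 0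
  have e1 : z.v (-1) (-1) rfl = f₁ := by
    simp [z, Cochain.single_v, Cochain.single_v_eq_zero]
  have e0 : z.v 0 0 rfl = f₀ := by
    simp [z, Cochain.single_v, Cochain.single_v_eq_zero]
  have hz : δ 0 1 z = 0 := by
    ext p q hpq
    by_cases hp : p = -1
    · subst hp
      obtain rfl : q = 0 := by omega
      rw [δ_v 0 1 rfl _ (-1) 0 rfl (-1) 0 rfl rfl, e1, e0]
      simp [h]
    · by_cases hp' : p = 0
      · subst hp'
        exact (hZ q (by omega) (by omega)).eq_of_tgt _ _
      · exact (hU p hp hp').eq_of_src _ _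
  exact ⟨Cocycle.homOf (Cocycle.mk z 1 rfl hz), e1, e0⟩

/-- A criterion for the vanishing of all graded maps between two-term complexes. -/
theorem forall_hom_shift_eq_zero (hU : IsTwoTerm U) (hZ : IsTwoTerm Z)
    (h1 : ∀ h : U.X (-1) ⟶ Z.X 0, ∃ (a : U.X (-1) ⟶ Z.X (-1)) (b : U.X 0 ⟶ Z.X 0),
        h = a ≫ Z.d (-1) 0 + U.d (-1) 0 ≫ b)
    (h0 : ∀ (f₁ : U.X (-1) ⟶ Z.X (-1)) (f₀ : U.X 0 ⟶ Z.X 0),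
      f₁ ≫ Z.d (-1) 0 = U.d (-1) 0 ≫ f₀ →
        ∃ s : U.X 0 ⟶ Z.X (-1), f₁ = U.d (-1) 0 ≫ s ∧ f₀ = s ≫ Z.d (-1) 0)
    (hneg : ∀ g : U.X 0 ⟶ Z.X (-1), U.d (-1) 0 ≫ g = 0 → g ≫ Z.d (-1) 0 = 0 → g = 0)
    (n : ℤ) (f : toHo U ⟶ (toHo Z)⟦n⟧) : f = 0 := by
  by_cases hn1 : n = 1
  · subst hn1
    exact (hom_shift_one_eq_zero_iff hU hZ).2 h1 f
  by_cases hn0 : n = 0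
  · subst hn0
    have key : ∀ g : toHo U ⟶ toHo Z, g = 0 := fun g => by
      obtain ⟨φ, rfl⟩ := (HomotopyCategory.quotient C (ComplexShape.up ℤ)).map_surjective g
      exact (quotient_map_eq_zero_iff hU hZ φ).2 (h0 _ _ (φ.comm (-1) 0))
    have := key (f ≫ ((shiftFunctorZero (HomotopyCategory C (ComplexShape.up ℤ)) ℤ).app
      (toHo Z)).hom)
    rwa [Preadditive.IsIso.comp_right_eq_zero] at this
  -- Of the remaining degrees only `n = -1` admits a nonzero component, `U⁰ ⟶ Z⁻¹`, and the two
  -- cocycle equations are the premises of `hneg`.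
  refine (forall_hom_eq_zero_iff U Z n).2 (fun z => ?_) f
  suffices z = 0 by rw [this]; exact AddSubgroup.zero_mem _
  ext p q hpq
  by_cases hq : q = -1 ∨ q = 0
  · by_cases hp : p = -1 ∨ p = 0
    · obtain rfl : n = -1 := by omega
      obtain rfl : p = 0 := by omega
      obtain rfl : q = -1 := by omega
      have hz := z.δ_eq_zero 0
      have e1 := Cochain.congr_v hz (-1) (-1) rfl
      rw [δ_v (-1) 0 rfl _ (-1) (-1) rfl (-2) 0 rfl rfl,
        (hZ (-2) (by omega) (by omega)).eq_of_tgt (z.1.v (-1) (-2) rfl) 0] at e1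
      have e0 := Cochain.congr_v hz 0 0 rfl
      rw [δ_v (-1) 0 rfl _ 0 0 rfl (-1) 1 rfl rfl,
        (hU 1 (by omega) (by omega)).eq_of_src (z.1.v 1 0 rfl) 0] at e0
      refine hneg _ ?_ ?_
      · simpa using e1
      · simpa using e0
    · exact (hU p (by omega) (by omega)).eq_of_src _ _
  · exact (hZ q (by omega) (by omega)).eq_of_tgt _ _

end TwoTerm

end

noncomputable section

/-! ### The Nakayama functor on finitely generated projective modules -/

/-- The right regular module. -/
def regularEquiv (A : Type u) [Ring A] : Aᵐᵒᵖ ≃ₗ[Aᵐᵒᵖ] A where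
  toFun := MulOpposite.unop
  invFun := MulOpposite.op
  map_add' _ _ := rfl
  map_smul' _ _ := rfl

instance finite_regular (A : Type u) [Ring A] :
    Module.Finite Aᵐᵒᵖ (ModuleCat.of Aᵐᵒᵖ A : RMod A) :=
  Module.Finite.equiv (regularEquiv A)

instance projective_regular (A : Type u) [Ring A] :
    Module.Projective Aᵐᵒᵖ (ModuleCat.of Aᵐᵒᵖ A : RMod A) :=
  Module.Projective.of_equiv (regularEquiv A)

namespace NakayamaObj

variable (K : Type u) [Field K] {A : Type u} [Ring A] [Algebra K A]

/-- A dual basis of a finitely generated projective module. -/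
theorem exists_dualBasis (P : RMod A) [Module.Finite Aᵐᵒᵖ P] [Module.Projective Aᵐᵒᵖ P] :
    ∃ (n : ℕ) (p : Fin n → P) (f : Fin n → (P →ₗ[Aᵐᵒᵖ] A)),
      ∀ x, x = ∑ i, MulOpposite.op (f i x) • p i := by
  obtain ⟨n, π, σ, -, -, h⟩ := Module.Finite.exists_comp_eq_id_of_projective Aᵐᵒᵖ P
  let u : Aᵐᵒᵖ →ₗ[Aᵐᵒᵖ] A := regularEquiv A
  refine ⟨n, fun i => π (Pi.single i 1), fun i => u ∘ₗ LinearMap.proj i ∘ₗ σ, fun x => ?_⟩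
  have h1 : π (σ x) = x := LinearMap.congr_fun h x
  conv_lhs => rw [← h1, ← Finset.univ_sum_single (σ x), map_sum]
  refine Finset.sum_congr rfl fun i _ => ?_
  rw [← map_smul]
  congr 1
  ext j
  by_cases hj : j = i
  · subst hj; simp [u, regularEquiv]
  · simp [hj]

theorem toForm_smul {X : RMod A} (a : A) (φ : NakayamaObj K X) (f : X →ₗ[Aᵐᵒᵖ] A) :
    toForm (MulOpposite.op a • φ) f = toForm φ (a • f) := rfl

theorem toForm_ext {X : RMod A} {φ ψ : NakayamaObj K X}
    (h : ∀ f, toForm φ f = toForm ψ f) : φ = ψ := LinearMap.ext h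

theorem algebraMap_smul_hom {X : RMod A} (k : K) (f : X →ₗ[Aᵐᵒᵖ] A) :
    k • f = algebraMap K A k • f :=
  LinearMap.ext fun x => Algebra.smul_def k (f x)

/-- The multiplication action of the field on `D Hom_A(X, A)`. -/
instance (X : RMod A) : Module K (NakayamaObj K X) :=
  inferInstanceAs (Module K ((X →ₗ[Aᵐᵒᵖ] A) →ₗ[K] K))

theorem algebraMap_smul {X : RMod A} (k : K) (φ : NakayamaObj K X) :
    MulOpposite.op (algebraMap K A k) • φ = k • φ := by
  refine toForm_ext K fun f => ?_
  rw [toForm_smul, ← algebraMap_smul_hom]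
  exact map_smul (toForm φ) k f

instance (X : RMod A) : IsScalarTower K Aᵐᵒᵖ (NakayamaObj K X) where
  smul_assoc k a φ := by
    rw [← algebraMap_smul, ← mul_smul]
    congr 1
    apply MulOpposite.unop_injective
    rw [MulOpposite.unop_smul, MulOpposite.unop_mul, MulOpposite.unop_op, Algebra.smul_def,
      Algebra.commutes]

instance : (nakayama K A).Linear K where
  map_smul {X Y} f k := by
    ext φ
    change NakayamaObj K X at φ
    refine toForm_ext K fun h => ?_
    change toForm φ (h ∘ₗ (k • f).hom) = toForm φ ((algebraMap K A k • h) ∘ₗ f.hom)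
    congr 1
    ext x
    change h (MulOpposite.op (algebraMap K A k) • f.hom x) = algebraMap K A k * h (f.hom x)
    rw [map_smul, Algebra.commutes]
    rfl

/-- The map `x ↦ n f(x)` for a linear form `f`. -/
def coev {P N : RMod A} (n : N) (f : P →ₗ[Aᵐᵒᵖ] A) : P ⟶ N :=
  ModuleCat.ofHom
    { toFun := fun x => MulOpposite.op (f x) • n
      map_add' := fun x y => by rw [map_add, MulOpposite.op_add, add_smul]
      map_smul' := fun a x => by
        rw [map_smul, RingHom.id_apply, ← mul_smul]
        rfl }

/-- The map `N ⟶ ν P` which corresponds to a linear form on `Hom(P, N)`. -/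
def ofForm {P N : RMod A} (ψ : (P ⟶ N) →ₗ[K] K) : N ⟶ (nakayama K A).obj P :=
  ModuleCat.ofHom
    { toFun := fun n => (show NakayamaObj K P from
        { toFun := fun f => ψ (coev n f)
          map_add' := fun f g => by
            rw [← map_add]
            congr 1
            ext x
            change MulOpposite.op (f x + g x) • n = _
            rw [MulOpposite.op_add, add_smul]
            rfl
          map_smul' := fun k f => by
            rw [RingHom.id_apply, ← map_smul]
            congr 1
            ext x
            change MulOpposite.op (k • f x) • n =
              MulOpposite.op (algebraMap K A k) • MulOpposite.op (f x) • n
            rw [← mul_smul, ← MulOpposite.op_mul, Algebra.smul_def, Algebra.commutes] })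
      map_add' := fun m n => toForm_ext K fun f => by
        change ψ (coev (m + n) f) = ψ (coev m f) + ψ (coev n f)
        rw [← map_add]
        congr 1
        ext x
        exact smul_add _ _ _
      map_smul' := fun a n => toForm_ext K fun f => by
        change ψ (coev (a • n) f) = ψ (coev n (a.unop • f))
        congr 1
        ext x
        change MulOpposite.op (f x) • a • n = MulOpposite.op (a.unop * f x) • n
        rw [← mul_smul, MulOpposite.op_mul, MulOpposite.op_unop] }

theorem ofForm_apply {P N : RMod A} (ψ : (P ⟶ N) →ₗ[K] K) (n : N) (f : P →ₗ[Aᵐᵒᵖ] A) :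
    toForm (show NakayamaObj K P from (ofForm K ψ).hom n) f = ψ (coev n f) := rfl

/-- `Hom(N, ν P) ≅ D Hom(P, N)`: surjectivity. -/
theorem exists_ofForm {P : RMod A} [Module.Finite Aᵐᵒᵖ P] [Module.Projective Aᵐᵒᵖ P]
    {N : RMod A} (g : N ⟶ (nakayama K A).obj P) : ∃ ψ : (P ⟶ N) →ₗ[K] K, ofForm K ψ = g := by
  obtain ⟨n, p, e, hpe⟩ := exists_dualBasis P
  let G : N →ₗ[Aᵐᵒᵖ] NakayamaObj K P := g.hom
  -- The form is a trace: evaluate `G ∘ h` on the dual basis `(p i, e i)` and sum.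
  refine ⟨
    { toFun := fun h => ∑ i, toForm (G (h.hom (p i))) (e i)
      map_add' := fun h h' => by
        rw [← Finset.sum_add_distrib]
        refine Finset.sum_congr rfl fun i _ => ?_
        change toForm (G (h.hom (p i) + h'.hom (p i))) (e i) = _
        rw [map_add]
        rfl
      map_smul' := fun k h => by
        rw [RingHom.id_apply, Finset.smul_sum]
        refine Finset.sum_congr rfl fun i _ => ?_
        change toForm (G (MulOpposite.op (algebraMap K A k) • h.hom (p i))) (e i) = _
        rw [map_smul, algebraMap_smul]
        rfl }, ?_⟩
  ext m
  refine toForm_ext K fun f => ?_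
  change ∑ i, toForm (G (MulOpposite.op (f (p i)) • m)) (e i) = toForm (G m) f
  have h1 : ∀ i, toForm (G (MulOpposite.op (f (p i)) • m)) (e i) =
      toForm (G m) (f (p i) • e i) := fun i => by rw [map_smul, toForm_smul]
  rw [Finset.sum_congr rfl fun i _ => h1 i, ← map_sum]
  congr 1
  ext x
  conv_rhs => rw [hpe x, map_sum]
  rw [LinearMap.sum_apply]
  refine Finset.sum_congr rfl fun i _ => ?_
  rw [map_smul]
  rfl

/-- Maps to `ν P` are linear forms on `Hom(P, -)`. A monomorphism induces an injection on `Hom(P,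
-)`, along which forms extend since `K` is a field. -/
theorem injective_obj (P : RMod A) [Module.Finite Aᵐᵒᵖ P] [Module.Projective Aᵐᵒᵖ P] :
    Injective ((nakayama K A).obj P) where
  factors {N N'} g i hi := by
    obtain ⟨ψ, rfl⟩ := exists_ofForm K g
    obtain ⟨l, hl⟩ := (Linear.rightComp K P i).exists_leftInverse_of_injective
      (LinearMap.ker_eq_bot.2 fun a b h => (cancel_mono i).1 h)
    refine ⟨ofForm K (ψ ∘ₗ l), ?_⟩
    ext n
    refine toForm_ext K fun f => ?_
    change ψ (l (coev (i.hom n) f)) = ψ (coev n f)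
    congr 1
    have : coev (i.hom n) f = Linear.rightComp K P i (coev n f) := by
      ext x
      exact (map_smul i.hom _ n).symm
    rw [this]
    exact LinearMap.congr_fun hl (coev n f)

/-- `Hom(N, ν A)` is the dual of `Hom(A, N) ≅ N`, and linear forms separate the points of `N`. -/
theorem isZero_of_hom_eq_zero {N : RMod A}
    (h : ∀ f : N ⟶ (nakayama K A).obj (ModuleCat.of Aᵐᵒᵖ A), f = 0) : IsZero N := by
  rw [ModuleCat.isZero_iff_subsingleton]
  refine subsingleton_of_forall_eq 0 fun n => ?_
  let idA : (ModuleCat.of Aᵐᵒᵖ A : RMod A) →ₗ[Aᵐᵒᵖ] A := LinearMap.id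
  have h1 : coev n idA = 0 := by
    rw [← Module.forall_dual_apply_eq_zero_iff K]
    intro ψ
    rw [← ofForm_apply K ψ n idA, h (ofForm K ψ)]
    rfl
  have h2 := congrArg (fun f : (ModuleCat.of Aᵐᵒᵖ A : RMod A) ⟶ N => f.hom (1 : A)) h1
  change MulOpposite.op (1 : A) • n = 0 at h2
  rwa [MulOpposite.op_one, one_smul] at h2

theorem map_injective {P Q : RMod A} [Module.Finite Aᵐᵒᵖ Q] [Module.Projective Aᵐᵒᵖ Q]
    (g : P ⟶ Q) (hg : (nakayama K A).map g = 0) : g = 0 := by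
  obtain ⟨n, q, e, hqe⟩ := exists_dualBasis Q
  have h1 : ∀ f : Q →ₗ[Aᵐᵒᵖ] A, f ∘ₗ g.hom = 0 := fun f => by
    rw [← Module.forall_dual_apply_eq_zero_iff K]
    intro φ
    exact LinearMap.congr_fun (congrArg
      (fun G : (nakayama K A).obj P ⟶ (nakayama K A).obj Q => G.hom φ) hg) f
  ext x
  rw [hqe (g.hom x)]
  refine Finset.sum_eq_zero fun i _ => ?_
  have : e i (g.hom x) = 0 := LinearMap.congr_fun (h1 (e i)) x
  rw [this, MulOpposite.op_zero, zero_smul]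

/-- `ν d` is the `K`-dual of precomposition with `d`, and the dual of an injection is surjective. -/
theorem epi_map {P Q : RMod A} (d : P ⟶ Q)
    (h : ∀ f : Q ⟶ ModuleCat.of Aᵐᵒᵖ A, d ≫ f = 0 → f = 0) : Epi ((nakayama K A).map d) := by
  rw [ModuleCat.epi_iff_surjective]
  refine LinearMap.dualMap_surjective_of_injective (f := precomp K d) ?_
  rw [← LinearMap.ker_eq_bot, eq_bot_iff]
  intro f hf
  exact congrArg ModuleCat.Hom.hom (h (ModuleCat.ofHom f) (ModuleCat.hom_ext hf))

section Finite

variable [Module.Finite K A]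

theorem finite_linearForms (P : RMod A) [Module.Finite Aᵐᵒᵖ P] :
    Module.Finite K (P →ₗ[Aᵐᵒᵖ] A) := by
  obtain ⟨n, s, hs⟩ := Module.Finite.exists_fin (R := Aᵐᵒᵖ) (M := P)
  let e : (P →ₗ[Aᵐᵒᵖ] A) →ₗ[K] (Fin n → A) :=
    { toFun := fun f i => f (s i)
      map_add' := fun _ _ => rfl
      map_smul' := fun _ _ => rfl }
  exact Module.Finite.of_injective e fun f g h => LinearMap.ext_on_range hs (congrFun h)

instance finite_obj (P : RMod A) [Module.Finite Aᵐᵒᵖ P] :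
    Module.Finite Aᵐᵒᵖ ((nakayama K A).obj P) := by
  have := finite_linearForms K P
  have : Module.Finite K (NakayamaObj K P) :=
    inferInstanceAs (Module.Finite K (Module.Dual K (P →ₗ[Aᵐᵒᵖ] A)))
  exact Module.Finite.of_restrictScalars_finite K Aᵐᵒᵖ (NakayamaObj K P)

/-- By biduality of `Hom(P, A)` over `K`, `G` is the transpose of an `A`-linear `γ : Hom(Q, A) →
Hom(P, A)`. A dual basis `(q i, e i)` of `Q` turns `γ` into the map `x ↦ ∑ q i · γ (e i) x`. -/
theorem map_surjective {P Q : RMod A} [Module.Finite Aᵐᵒᵖ P] [Module.Finite Aᵐᵒᵖ Q]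
    [Module.Projective Aᵐᵒᵖ Q] (G : (nakayama K A).obj P ⟶ (nakayama K A).obj Q) :
    ∃ g : P ⟶ Q, (nakayama K A).map g = G := by
  have := finite_linearForms K P
  obtain ⟨n, q, e, hqe⟩ := exists_dualBasis Q
  let G' : NakayamaObj K P →ₗ[Aᵐᵒᵖ] NakayamaObj K Q := G.hom
  let γ : (Q →ₗ[Aᵐᵒᵖ] A) → (P →ₗ[Aᵐᵒᵖ] A) := fun f =>
    (Module.evalEquiv K (P →ₗ[Aᵐᵒᵖ] A)).symm
      { toFun := fun φ => toForm (G' (show NakayamaObj K P from φ)) f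
        map_add' := fun φ ψ => LinearMap.congr_fun (map_add G' _ _) f
        map_smul' := fun k φ => by
          change toForm (G' (k • (show NakayamaObj K P from φ))) f = _
          rw [← algebraMap_smul, map_smul, algebraMap_smul]
          rfl }
  have hγ : ∀ (φ : NakayamaObj K P) f, toForm φ (γ f) = toForm (G' φ) f := fun φ f =>
    Module.apply_evalEquiv_symm_apply K _ _ _
  have hext : ∀ f g : P →ₗ[Aᵐᵒᵖ] A, (∀ φ : NakayamaObj K P, toForm φ f = toForm φ g) → f = g := by
    intro f g h
    rw [← sub_eq_zero, ← Module.forall_dual_apply_eq_zero_iff K]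
    intro φ
    rw [map_sub, sub_eq_zero]
    exact h φ
  have hadd : ∀ f g, γ (f + g) = γ f + γ g := fun f g => hext _ _ fun φ => by
    rw [map_add, hγ, hγ, hγ, map_add]
  have hsmul : ∀ (a : A) f, γ (a • f) = a • γ f := fun a f => hext _ _ fun φ => by
    rw [hγ, ← toForm_smul, ← toForm_smul, hγ, map_smul]
  let Γ : (Q →ₗ[Aᵐᵒᵖ] A) →ₗ[A] (P →ₗ[Aᵐᵒᵖ] A) :=
    { toFun := γ, map_add' := hadd, map_smul' := hsmul }
  refine ⟨ModuleCat.ofHom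
    { toFun := fun x => ∑ i, MulOpposite.op (γ (e i) x) • q i
      map_add' := fun x y => by
        rw [← Finset.sum_add_distrib]
        refine Finset.sum_congr rfl fun i _ => ?_
        rw [map_add, MulOpposite.op_add, add_smul]
      map_smul' := fun a x => by
        rw [RingHom.id_apply, Finset.smul_sum]
        refine Finset.sum_congr rfl fun i _ => ?_
        rw [map_smul, ← mul_smul]
        rfl }, ?_⟩
  ext φ
  refine toForm_ext K fun h => ?_
  refine Eq.trans ?_ (hγ φ h)
  refine congrArg (toForm (show NakayamaObj K P from φ)) ?_
  have hh : h = ∑ i, h (q i) • e i := by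
    ext x
    conv_lhs => rw [hqe x, map_sum]
    rw [LinearMap.sum_apply]
    refine Finset.sum_congr rfl fun i _ => ?_
    rw [map_smul]
    rfl
  have h2 : γ h = ∑ i, h (q i) • γ (e i) := by
    conv_lhs => rw [hh]
    change Γ _ = _
    rw [map_sum]
    refine Finset.sum_congr rfl fun i _ => map_smul Γ _ _
  rw [h2]
  ext x
  change h (∑ i, MulOpposite.op (γ (e i) x) • q i) = _
  rw [map_sum, LinearMap.sum_apply]
  refine Finset.sum_congr rfl fun i _ => ?_
  rw [map_smul]
  rfl

include K in
/-- Finitely generated modules embed into finitely generated injective modules. -/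
theorem exists_mono_extInjective (N : RMod A) (hN : Module.Finite Aᵐᵒᵖ N) :
    ∃ (J : RMod A) (i : N ⟶ J), Module.Finite Aᵐᵒᵖ J ∧ Mono i ∧
      FiniteModule.IsExtInjective J := by
  have : IsNoetherianRing Aᵐᵒᵖ := IsNoetherianRing.of_finite K Aᵐᵒᵖ
  let I := (nakayama K A).obj (ModuleCat.of Aᵐᵒᵖ A)
  have hI : Injective I := injective_obj K _
  have : Module.Finite Aᵐᵒᵖ I := finite_obj K _
  obtain ⟨k, u, hu⟩ := FiniteModule.exists_approximation K N I
  refine ⟨_, u, inferInstance, Preadditive.mono_of_isZero_kernel _ ?_, fun Y _ => ?_⟩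
  · refine isZero_of_hom_eq_zero K fun f => ?_
    obtain ⟨g, hg⟩ := hu (Injective.factorThru f (kernel.ι u))
    rw [← Injective.comp_factorThru f (kernel.ι u), ← hg, kernel.condition_assoc, zero_comp]
  · have : Subsingleton (Abelian.Ext.{u} Y I 1) :=
      subsingleton_of_forall_eq 0 fun e => Abelian.Ext.eq_zero_of_injective e
    exact ExtVanishing.biproduct_right 1 k

end Finite

end NakayamaObj

end

noncomputable section

/-! ### Path algebras of finite dimension are hereditary -/

namespace PathAlgebra

open MulOpposite

variable (K : Type u) [Field K] {V : Type u} [DecidableEq V] [Quiver.{u} V]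

theorem ofPath_mul_ofPath {a b c : V} (p : Quiver.Path a b) (q : Quiver.Path b c) :
    ofPath K p * ofPath K q = ofPath K (p.comp q) := mulLin_ofPath_comp K p q

theorem ofPath_mul_ofPath_of_ne {a b c d : V} (p : Quiver.Path a b) (q : Quiver.Path c d)
    (h : b ≠ c) : ofPath K p * ofPath K q = 0 := mulLin_ofPath_of_ne K p q h

theorem ofPath_cons {a b c : V} (p : Quiver.Path a b) (e : b ⟶ c) :
    ofPath K (p.cons e) = ofPath K p * ofPath K e.toPath :=
  (ofPath_mul_ofPath K p e.toPath).symm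

variable [Fintype V]

variable (V) in
/-- The arrows of a quiver, each recorded with its source and its target. -/
abbrev Arrows : Type u := Σ a : V, Σ b : V, (a ⟶ b)

variable (V) in
/-- The right ideal generated by the arrows. -/
def arrowIdeal : Submodule (PathAlgebra K V)ᵐᵒᵖ (PathAlgebra K V) :=
  Submodule.span _ (Set.range fun α : Arrows V => ofPath K α.2.2.toPath)

theorem mul_mem_arrowIdeal {x : PathAlgebra K V} (hx : x ∈ arrowIdeal K V)
    (a : PathAlgebra K V) : x * a ∈ arrowIdeal K V :=
  (arrowIdeal K V).smul_mem (op a) hx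

theorem ofPath_toPath_mem {a b : V} (e : a ⟶ b) : ofPath K e.toPath ∈ arrowIdeal K V :=
  Submodule.subset_span ⟨⟨a, b, e⟩, rfl⟩

theorem ofPath_cons_mem {a b c : V} (p : Quiver.Path a b) (e : b ⟶ c) :
    ofPath K (p.cons e) ∈ arrowIdeal K V := by
  induction p generalizing c with
  | nil => exact ofPath_toPath_mem K e
  | cons p f ih =>
    rw [ofPath_cons]
    exact mul_mem_arrowIdeal K (ih f) _

/-- The components of a path with respect to its first arrow. -/
def firstArrow {a : V} : {b : V} → Quiver.Path a b → (Arrows V →₀ PathAlgebra K V)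
  | _, .nil => 0
  | c, .cons (b := b) p e => op (ofPath K e.toPath) • firstArrow p +
      if p.length = 0 then
        Finsupp.single ⟨b, c, e⟩ (ofPath K (Quiver.Path.nil : Quiver.Path c c))
      else 0

theorem firstArrow_toPath {a b : V} (e : a ⟶ b) :
    firstArrow K e.toPath = 
      Finsupp.single ⟨a, b, e⟩ (ofPath K (Quiver.Path.nil : Quiver.Path b b)) := by
  simp [Quiver.Hom.toPath, firstArrow]

theorem firstArrow_comp {a b c : V} (e : a ⟶ b) (q : Quiver.Path b c) :
    firstArrow K (e.toPath.comp q) = op (ofPath K q) • firstArrow K e.toPath := by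
  induction q with
  | nil =>
    rw [Quiver.Path.comp_nil, firstArrow_toPath, Finsupp.smul_single]
    exact congrArg _ (ofPath_mul_ofPath K (Quiver.Path.nil : Quiver.Path b b) Quiver.Path.nil).symm
  | cons q f ih =>
    rw [Quiver.Path.comp_cons, firstArrow, ih, if_neg (by simp), add_zero, ← mul_smul, ← op_mul,
      ← ofPath_cons]

/-- The components of an element with respect to the first arrows of paths. -/
def firstArrowLin : PathAlgebra K V →ₗ[K] (Arrows V →₀ PathAlgebra K V) :=
  Finsupp.linearCombination K fun p : QuiverPaths V => firstArrow K p.2.2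

theorem firstArrowLin_ofPath {a b : V} (p : Quiver.Path a b) :
    firstArrowLin K (ofPath K p) = firstArrow K p := by
  unfold firstArrowLin ofPath
  erw [Finsupp.linearCombination_single, one_smul]

theorem op_smul_smul_comm (k : K) (a : PathAlgebra K V) (x : Arrows V →₀ PathAlgebra K V) :
    op (k • a) • x = k • op a • x := by
  ext1 i
  exact mul_smul_comm k (x i) a

theorem firstArrowLin_arrow_mul {a b : V} (e : a ⟶ b) (x : PathAlgebra K V) :
    firstArrowLin K (ofPath K e.toPath * x) = op x • firstArrow K e.toPath := by
  induction x using PathAlgebra.induction with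
  | zero => simp
  | add x y hx hy => rw [mul_add, map_add, hx, hy, MulOpposite.op_add, add_smul]
  | @smul k c d q =>
    rw [mul_smul_comm, map_smul, op_smul_smul_comm]
    congr 1
    by_cases h : b = c
    · subst h
      rw [ofPath_mul_ofPath, firstArrowLin_ofPath, firstArrow_comp]
    · rw [ofPath_mul_ofPath_of_ne K _ _ h, map_zero, firstArrow_toPath, Finsupp.smul_single]
      have : op (ofPath K q) • ofPath K (Quiver.Path.nil : Quiver.Path b b) = 0 :=
        ofPath_mul_ofPath_of_ne K _ _ h
      rw [this, Finsupp.single_zero]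

/-- Linearity fails outside the ideal: a trivial path has no first arrow, while its product with an
arrow may have one. -/
theorem firstArrowLin_mul {x : PathAlgebra K V} (hx : x ∈ arrowIdeal K V) :
    ∀ a : PathAlgebra K V, firstArrowLin K (x * a) = op a • firstArrowLin K x := by
  induction hx using Submodule.span_induction with
  | mem x hx =>
    obtain ⟨α, rfl⟩ := hx
    intro a
    rw [firstArrowLin_arrow_mul, firstArrowLin_ofPath]
  | zero => simp
  | add x y _ _ hx hy => intro a; rw [add_mul, map_add, hx, hy, map_add, smul_add]
  | smul b x _ hx =>
    intro a
    have h1 : b • x = x * b.unop := rfl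
    rw [h1, mul_assoc, hx, hx, op_mul, mul_smul]

/-- The map which sends the basis vector at an arrow to this arrow. -/
def arrowsToIdeal : (Arrows V →₀ PathAlgebra K V) →ₗ[(PathAlgebra K V)ᵐᵒᵖ] PathAlgebra K V :=
  Finsupp.lsum ℕ fun α : Arrows V =>
    { toFun := fun x => ofPath K α.2.2.toPath * x
      map_add' := fun _ _ => mul_add _ _ _
      map_smul' := fun _ _ => (mul_assoc _ _ _).symm }

theorem arrowsToIdeal_single (α : Arrows V) (x : PathAlgebra K V) :
    arrowsToIdeal K (Finsupp.single α x) = ofPath K α.2.2.toPath * x := by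
  simp [arrowsToIdeal]

theorem arrowsToIdeal_mem (x : Arrows V →₀ PathAlgebra K V) :
    arrowsToIdeal K x ∈ arrowIdeal K V := by
  induction x using Finsupp.induction_linear with
  | zero => simp
  | add x y hx hy => rw [map_add]; exact Submodule.add_mem _ hx hy
  | single α x =>
    rw [arrowsToIdeal_single]
    exact mul_mem_arrowIdeal K (ofPath_toPath_mem K _) x

theorem arrowsToIdeal_firstArrowLin {x : PathAlgebra K V} (hx : x ∈ arrowIdeal K V) :
    arrowsToIdeal K (firstArrowLin K x) = x := by
  induction hx using Submodule.span_induction with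
  | mem x hx =>
    obtain ⟨α, rfl⟩ := hx
    rw [firstArrowLin_ofPath, firstArrow_toPath, arrowsToIdeal_single, ofPath_mul_ofPath,
      Quiver.Path.comp_nil]
  | zero => simp
  | add x y _ _ hx hy => rw [map_add, map_add, hx, hy]
  | smul b x h hx =>
    have h1 : b • x = x * b.unop := rfl
    rw [h1, firstArrowLin_mul K h, map_smul, hx]
    rfl

/-- A path of positive length has a unique first arrow. Removing it gives a right linear section of
the map from the free module on the arrows onto the ideal. -/
theorem projective_arrowIdeal : Module.Projective (PathAlgebra K V)ᵐᵒᵖ (arrowIdeal K V) := by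
  have : Module.Free (PathAlgebra K V)ᵐᵒᵖ (PathAlgebra K V) :=
    Module.Free.of_equiv (regularEquiv (PathAlgebra K V))
  let s : arrowIdeal K V →ₗ[(PathAlgebra K V)ᵐᵒᵖ] (Arrows V →₀ PathAlgebra K V) :=
    { toFun := fun x => firstArrowLin K x.1
      map_add' := fun x y => map_add _ _ _
      map_smul' := fun a x => firstArrowLin_mul K x.2 a.unop }
  refine Module.Projective.of_split s
    ((arrowsToIdeal K).codRestrict (arrowIdeal K V) (arrowsToIdeal_mem K)) ?_
  ext x
  exact arrowsToIdeal_firstArrowLin K x.2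

theorem hasProjectiveDimensionLE_quotient :
    HasProjectiveDimensionLE (ModuleCat.of (PathAlgebra K V)ᵐᵒᵖ
      (PathAlgebra K V ⧸ arrowIdeal K V)) 1 := by
  have := projective_arrowIdeal K (V := V)
  have : Module.Projective (PathAlgebra K V)ᵐᵒᵖ (PathAlgebra K V) :=
    projective_regular (PathAlgebra K V)
  let S : ShortComplex (RMod (PathAlgebra K V)) :=
    ShortComplex.mk (ModuleCat.ofHom (arrowIdeal K V).subtype)
      (ModuleCat.ofHom (arrowIdeal K V).mkQ) (by ext x; simp)
  have hS : S.ShortExact :=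
    { exact := (ShortComplex.ShortExact.moduleCat_exact_iff_function_exact S).2
        (LinearMap.exact_subtype_mkQ _)
      mono_f := (ModuleCat.mono_iff_injective _).2 (Submodule.subtype_injective _)
      epi_g := (ModuleCat.epi_iff_surjective _).2 (Submodule.mkQ_surjective _) }
  have h1 : Projective S.X₁ := (IsProjective.iff_projective _).1 (by assumption)
  have h2 : Projective S.X₂ := (IsProjective.iff_projective _).1 (by assumption)
  exact hS.hasProjectiveDimensionLT_X₃ 1 inferInstance inferInstance

/-! ### Elements killed by all arrows -/

section Socle

variable {K}
variable {M : RMod (PathAlgebra K V)} (m : M) (v : V)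
  (hv : op (ofPath K (Quiver.Path.nil : Quiver.Path v v)) • m = m)
  (hm : ∀ {a b : V} (e : a ⟶ b), op (ofPath K e.toPath) • m = 0)

include hm in
theorem smul_eq_zero_of_mem {x : PathAlgebra K V} (hx : x ∈ arrowIdeal K V) : op x • m = 0 := by
  induction hx using Submodule.span_induction with
  | mem x hx =>
    obtain ⟨α, rfl⟩ := hx
    exact hm _
  | zero => simp
  | add x y _ _ hx hy => rw [MulOpposite.op_add, add_smul, hx, hy, add_zero]
  | smul b x _ hx =>
    have h1 : b • x = x * b.unop := rfl
    rw [h1, op_mul, mul_smul, hx, smul_zero]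

variable (K) in
theorem exists_nil_mul_sub_mem (x : PathAlgebra K V) :
    ∃ c : K, ofPath K (Quiver.Path.nil : Quiver.Path v v) * x -
      c • ofPath K (Quiver.Path.nil : Quiver.Path v v) ∈ arrowIdeal K V := by
  induction x using PathAlgebra.induction with
  | zero => exact ⟨0, by simp⟩
  | add x y hx hy =>
    obtain ⟨c, hc⟩ := hx
    obtain ⟨d, hd⟩ := hy
    refine ⟨c + d, ?_⟩
    rw [mul_add, add_smul, add_sub_add_comm]
    exact Submodule.add_mem _ hc hd
  | @smul k a b p =>
    by_cases h : v = a
    · subst h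
      rw [mul_smul_comm, ofPath_mul_ofPath, Quiver.Path.nil_comp]
      cases p with
      | nil => exact ⟨k, by simp⟩
      | cons p e =>
        refine ⟨0, ?_⟩
        rw [zero_smul, sub_zero, ← mul_one (ofPath K _), ← mul_smul_comm]
        exact mul_mem_arrowIdeal K (ofPath_cons_mem K p e) _
    · refine ⟨0, ?_⟩
      rw [mul_smul_comm, ofPath_mul_ofPath_of_ne K _ _ h]
      simp

/-- The map `x ↦ m x`. -/
def orbitMap : PathAlgebra K V →ₗ[(PathAlgebra K V)ᵐᵒᵖ] M where
  toFun x := op x • m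
  map_add' x y := by rw [MulOpposite.op_add, add_smul]
  map_smul' a x := by
    have h1 : a • x = x * a.unop := rfl
    rw [h1, op_mul, mul_smul]
    rfl

-- The module generated by `m` is `A / ann m`, a retract of `A / J` for the arrow ideal `J`: left
-- multiplication by the trivial path at `v` is the section. It sends `ann m` into `J`, because its
-- coefficient at the trivial path would otherwise make `m` zero.
include hv hm in
theorem hasProjectiveDimensionLE_range (h0 : m ≠ 0) :
    HasProjectiveDimensionLE (ModuleCat.of (PathAlgebra K V)ᵐᵒᵖ (orbitMap m).range) 1 := by
  let ε := ofPath K (Quiver.Path.nil : Quiver.Path v v)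
  let L : PathAlgebra K V →ₗ[(PathAlgebra K V)ᵐᵒᵖ] PathAlgebra K V :=
    { toFun := fun x => ε * x
      map_add' := fun _ _ => mul_add _ _ _
      map_smul' := fun _ _ => (mul_assoc _ _ _).symm }
  have hL : (orbitMap m).ker ≤ (arrowIdeal K V).comap L := by
    intro x hx
    obtain ⟨c, hc⟩ := exists_nil_mul_sub_mem K v x
    have h1 := smul_eq_zero_of_mem m hm hc
    have h2 : op x • m = 0 := hx
    have h3 : op (c • ε) • m = op (algebraMap K (PathAlgebra K V) c) • m := by
      conv_rhs => rw [← hv]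
      rw [← mul_smul, ← op_mul, Algebra.smul_def, Algebra.commutes]
    rw [MulOpposite.op_sub, sub_smul, op_mul, mul_smul, hv, h2, zero_sub, neg_eq_zero, h3] at h1
    have hc0 : c = 0 := by
      by_contra hne
      apply h0
      have h4 : op (algebraMap K (PathAlgebra K V) c⁻¹) •
          op (algebraMap K (PathAlgebra K V) c) • m = m := by
        rw [← mul_smul, ← op_mul, ← map_mul, mul_inv_cancel₀ hne, map_one, op_one, one_smul]
      rw [← h4, h1, smul_zero]
    rw [hc0, zero_smul, sub_zero] at hc
    exact hc
  have hJ : arrowIdeal K V ≤ (orbitMap m).ker.comap LinearMap.id := fun x hx =>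
    smul_eq_zero_of_mem m hm hx
  have := hasProjectiveDimensionLE_quotient K (V := V)
  let r : Retract (ModuleCat.of (PathAlgebra K V)ᵐᵒᵖ (PathAlgebra K V ⧸ (orbitMap m).ker))
      (ModuleCat.of (PathAlgebra K V)ᵐᵒᵖ (PathAlgebra K V ⧸ arrowIdeal K V)) :=
    { i := ModuleCat.ofHom (Submodule.mapQ _ _ L hL)
      r := ModuleCat.ofHom (Submodule.mapQ _ _ LinearMap.id hJ)
      retract := by
        apply ModuleCat.hom_ext
        refine Submodule.linearMap_qext _ (LinearMap.ext fun x => ?_)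
        refine (Submodule.Quotient.eq _).2 ?_
        change op (ε * x - x) • m = 0
        rw [MulOpposite.op_sub, sub_smul, op_mul, mul_smul, hv, sub_self] }
  have h5 := r.hasProjectiveDimensionLT 2
  exact hasProjectiveDimensionLT_of_iso (orbitMap m).quotKerEquivRange.toModuleIso 2

end Socle

variable [Finite (QuiverPaths V)]

instance : Module.Finite K (PathAlgebra K V) :=
  inferInstanceAs (Module.Finite K (QuiverPaths V →₀ K))

/-- Otherwise one can keep applying arrows to a nonzero element, and arbitrarily long paths act
nontrivially; but path lengths are bounded. -/
theorem exists_arrow_smul_eq_zero (M : RMod (PathAlgebra K V)) [Nontrivial M] :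
    ∃ m : M, m ≠ 0 ∧ ∀ {a b : V} (e : a ⟶ b), op (ofPath K e.toPath) • m = 0 := by
  by_contra! h
  obtain ⟨m, hm⟩ := exists_ne (0 : M)
  have key : ∀ n : ℕ, ∃ (a b : V) (p : Quiver.Path a b), n ≤ p.length ∧ op (ofPath K p) • m ≠ 0 := by
    intro n
    induction n with
    | zero =>
      by_contra! h'
      apply hm
      rw [← one_smul (PathAlgebra K V)ᵐᵒᵖ m, ← op_one, one_eq, Finset.op_sum, Finset.sum_smul]
      exact Finset.sum_eq_zero fun v _ => h' v v Quiver.Path.nil (Nat.zero_le _)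
    | succ n ih =>
      obtain ⟨a, b, p, hp, hp'⟩ := ih
      obtain ⟨c, d, e, he⟩ := h _ hp'
      rw [← mul_smul, ← op_mul] at he
      by_cases hbc : b = c
      · subst hbc
        refine ⟨a, d, p.cons e, by simpa using hp, ?_⟩
        rwa [ofPath_cons]
      · rw [ofPath_mul_ofPath_of_ne K _ _ hbc, MulOpposite.op_zero, zero_smul] at he
        exact absurd rfl he
  obtain ⟨N, hN⟩ := (Set.finite_range fun p : QuiverPaths V => p.2.2.length).bddAbove
  obtain ⟨a, b, p, hp, -⟩ := key (N + 1)
  have := hN ⟨⟨a, b, p⟩, rfl⟩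
  dsimp only at this
  omega

/-- Induction on the length: divide by the submodule generated by an element at one vertex that all
arrows kill. -/
theorem hasProjectiveDimensionLE_of_length (n : ℕ) : ∀ M : RMod (PathAlgebra K V),
    Module.Finite (PathAlgebra K V)ᵐᵒᵖ M → Module.length (PathAlgebra K V)ᵐᵒᵖ M ≤ n →
      HasProjectiveDimensionLE M 1 := by
  have : IsArtinianRing (PathAlgebra K V)ᵐᵒᵖ := IsArtinianRing.of_finite K _
  induction n with
  | zero =>
    intro M _ hM
    have : Subsingleton M := by
      rwa [Nat.cast_zero, nonpos_iff_eq_zero, Module.length_eq_zero_iff] at hM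
    have := (ModuleCat.isZero_of_subsingleton M).hasProjectiveDimensionLT_zero
    exact hasProjectiveDimensionLT_of_ge M 0 2 (by omega)
  | succ n ih =>
    intro M _ hM
    rcases subsingleton_or_nontrivial M with h | h
    · have := (ModuleCat.isZero_of_subsingleton M).hasProjectiveDimensionLT_zero
      exact hasProjectiveDimensionLT_of_ge M 0 2 (by omega)
    obtain ⟨m, hm0, hm⟩ := exists_arrow_smul_eq_zero K M
    obtain ⟨v, hv⟩ : ∃ v : V, op (ofPath K (Quiver.Path.nil : Quiver.Path v v)) • m ≠ 0 := by
      by_contra! h'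
      apply hm0
      rw [← one_smul (PathAlgebra K V)ᵐᵒᵖ m, ← op_one, one_eq, Finset.op_sum, Finset.sum_smul]
      exact Finset.sum_eq_zero fun v _ => h' v
    let m' : M := op (ofPath K (Quiver.Path.nil : Quiver.Path v v)) • m
    have hpd := hasProjectiveDimensionLE_range m' v
      (by rw [← mul_smul, ← op_mul, ofPath_mul_ofPath, Quiver.Path.comp_nil])
      (fun {a b} e => by
        rw [← mul_smul, ← op_mul]
        by_cases h : v = a
        · subst h
          rw [ofPath_mul_ofPath, Quiver.Path.nil_comp, hm]
        · rw [ofPath_mul_ofPath_of_ne K _ _ h, MulOpposite.op_zero, zero_smul]) hv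
    let N := (orbitMap m').range
    have hN : N ≠ ⊥ := fun h => hv ((Submodule.eq_bot_iff _).1 h m' ⟨1, by
      change op (1 : PathAlgebra K V) • m' = m'
      rw [op_one, one_smul]⟩)
    let S : ShortComplex (RMod (PathAlgebra K V)) :=
      ShortComplex.mk (ModuleCat.ofHom N.subtype) (ModuleCat.ofHom N.mkQ) (by ext x; simp)
    have hS : S.ShortExact :=
      { exact := (ShortComplex.ShortExact.moduleCat_exact_iff_function_exact S).2
          (LinearMap.exact_subtype_mkQ _)
        mono_f := (ModuleCat.mono_iff_injective _).2 (Submodule.subtype_injective _)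
        epi_g := (ModuleCat.epi_iff_surjective _).2 (Submodule.mkQ_surjective _) }
    have hlt : Module.length (PathAlgebra K V)ᵐᵒᵖ (M ⧸ N) ≤ n := by
      have : Nontrivial N := Submodule.nontrivial_iff_ne_bot.2 hN
      have h1 := Module.length_eq_add_of_exact N.subtype N.mkQ (Submodule.subtype_injective _)
        (Submodule.mkQ_surjective _) (LinearMap.exact_subtype_mkQ _)
      have h2 : 0 < Module.length (PathAlgebra K V)ᵐᵒᵖ N := Module.length_pos
      have : IsNoetherian (PathAlgebra K V)ᵐᵒᵖ M := isNoetherian_of_isNoetherianRing_of_finite _ M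
      have h3 : Module.length (PathAlgebra K V)ᵐᵒᵖ N ≠ ⊤ := Module.length_ne_top
      have h4 : Module.length (PathAlgebra K V)ᵐᵒᵖ (M ⧸ N) ≠ ⊤ := Module.length_ne_top
      rw [h1] at hM
      lift Module.length (PathAlgebra K V)ᵐᵒᵖ N to ℕ using h3 with a
      lift Module.length (PathAlgebra K V)ᵐᵒᵖ (M ⧸ N) to ℕ using h4 with b
      norm_cast at hM h2 ⊢
      omega
    exact hS.hasProjectiveDimensionLT_X₂ 2 hpd
      (ih (ModuleCat.of _ (M ⧸ N)) inferInstance hlt)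

theorem isHereditary : FiniteModule.IsHereditary (PathAlgebra K V)ᵐᵒᵖ := fun M _ => by
  have : IsArtinianRing (PathAlgebra K V)ᵐᵒᵖ := IsArtinianRing.of_finite K _
  have : IsNoetherian (PathAlgebra K V)ᵐᵒᵖ M := isNoetherian_of_isNoetherianRing_of_finite _ M
  obtain ⟨n, hn⟩ := ENat.ne_top_iff_exists.1
    (Module.length_ne_top (R := (PathAlgebra K V)ᵐᵒᵖ) (M := M))
  exact hasProjectiveDimensionLE_of_length K n M inferInstance hn.symm.le

end PathAlgebra

end

noncomputable section

/-! ### Dynkin quivers have finitely many paths -/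

namespace IsDynkinQuiver

/-- Each vertex has at most one neighbour that is smaller for the order given by `ord`. -/
def IsTreeOrder {n : ℕ} (C : Fin n → Fin n → ℤ) (ord : Fin n → ℕ) : Prop :=
  (∀ i j, ord i = ord j → i = j) ∧ (∀ i, C i i = 2) ∧ (∀ i j, i ≠ j → -1 ≤ C i j) ∧
    ∀ i j k, ord i < ord k → ord j < ord k → C i k ≠ 0 → C j k ≠ 0 → i = j

instance decidableIsTreeOrder {n : ℕ} (C : Fin n → Fin n → ℤ) (ord : Fin n → ℕ) :
    Decidable (IsTreeOrder C ord) := by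
  unfold IsTreeOrder
  infer_instance

instance {n : ℕ} (C : Matrix (Fin n) (Fin n) ℤ) (ord : Fin n → ℕ) : Decidable (IsTreeOrder C ord) :=
  decidableIsTreeOrder C ord

/-- The rows of the matrix `C` can be ordered such that each of them has at most one smaller
neighbour. -/
def HasTreeOrder {n : ℕ} (C : Matrix (Fin n) (Fin n) ℤ) : Prop :=
  ∃ ord : Fin n → ℕ, IsTreeOrder C ord

theorem hasTreeOrder_A (n : ℕ) : HasTreeOrder (CartanMatrix.A n) := by
  refine ⟨fun i => i.1, fun _ _ => Fin.ext, ?_, ?_, ?_⟩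
  · intro i
    simp [CartanMatrix.A]
  · intro i j hij
    simp only [CartanMatrix.A, Matrix.of_apply]
    split_ifs <;> simp
  · intro i j k hi hj h1 h2
    simp only [CartanMatrix.A, Matrix.of_apply, Fin.ext_iff] at h1 h2 ⊢
    grind

theorem hasTreeOrder_D (n : ℕ) : HasTreeOrder (CartanMatrix.D n) := by
  refine ⟨fun i => i.1, fun _ _ => Fin.ext, ?_, ?_, ?_⟩
  · intro i
    simp [CartanMatrix.D]
  · intro i j hij
    simp only [CartanMatrix.D, Matrix.of_apply]
    split_ifs <;> simp
  · intro i j k hi hj h1 h2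
    simp only [CartanMatrix.D, Matrix.of_apply, Fin.ext_iff] at h1 h2 ⊢
    grind

theorem hasTreeOrder_E₆ : HasTreeOrder CartanMatrix.E₆ :=
  -- The numbering is reversed because in the standard one the branch vertex has two smaller
  -- neighbours.
  ⟨fun i => 6 - i.1, by decide⟩

theorem hasTreeOrder_E₇ : HasTreeOrder CartanMatrix.E₇ :=
  ⟨fun i => 7 - i.1, by decide⟩

theorem hasTreeOrder_E₈ : HasTreeOrder CartanMatrix.E₈ :=
  ⟨fun i => 8 - i.1, by decide⟩

theorem hasTreeOrder_cartan : ∀ X : DynkinDiagram, HasTreeOrder X.cartan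
  | .A n => hasTreeOrder_A (n + 1)
  | .D n => hasTreeOrder_D (n + 4)
  | .E₆ => hasTreeOrder_E₆
  | .E₇ => hasTreeOrder_E₇
  | .E₈ => hasTreeOrder_E₈

variable {V : Type u} [DecidableEq V] [Quiver.{u} V]

/-- The orders of the components are used side by side. Vertices of different components may get
equal values, which is harmless since arrows stay inside a component. Opposite arrows are excluded
because off-diagonal entries are at least `-1`. -/
theorem exists_order_vertices (hV : IsDynkinQuiver V) : ∃ ord : V → ℕ,
    (∀ i j : V, Nonempty (i ⟶ j) → ord i ≠ ord j ∧ ¬Nonempty (j ⟶ i)) ∧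
    ∀ i j k : V, ord i < ord k → ord j < ord k → (Nonempty (i ⟶ k) ∨ Nonempty (k ⟶ i)) →
      (Nonempty (j ⟶ k) ∨ Nonempty (k ⟶ j)) → i = j := by
  obtain ⟨hfin, k, X, e, he⟩ := hV
  choose ord h1 h2 h3 h4 using fun s => hasTreeOrder_cartan (X s)
  have hpos : ∀ i j : V, Nonempty (i ⟶ j) → 0 < (Nat.card (i ⟶ j) : ℤ) := fun i j h => by
    have := hfin i j
    exact_mod_cast Nat.card_pos
  have hne : ∀ i j : V, Nonempty (i ⟶ j) → i ≠ j := by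
    rintro i j h rfl
    have := he i i
    rw [if_pos rfl, Matrix.blockDiagonal'_apply_eq, h2] at this
    have := hpos i i h
    omega
  have hent : ∀ i j : V, (Nonempty (i ⟶ j) ∨ Nonempty (j ⟶ i)) →
      Matrix.blockDiagonal' (fun s => (X s).cartan) (e i) (e j) < 0 := by
    intro i j h
    have hij : i ≠ j := h.elim (hne i j) fun h => (hne j i h).symm
    rw [← he, if_neg hij]
    rcases h with h | h
    · have := hpos i j h
      omega
    · have := hpos j i h
      omega
  have hblock : ∀ i j : V, (Nonempty (i ⟶ j) ∨ Nonempty (j ⟶ i)) → (e i).1 = (e j).1 := by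
    intro i j h
    by_contra hb
    have := hent i j h
    rw [Matrix.blockDiagonal'_apply, dif_neg hb] at this
    exact lt_irrefl _ this
  refine ⟨fun v => ord _ (e v).2, fun i j h => ⟨fun hij => ?_, fun h' => ?_⟩,
    fun i j l hi hj hil hjl => ?_⟩
  · have hb := hblock i j (Or.inl h)
    apply hne i j h
    apply e.injective
    dsimp only at hij
    rcases hei : e i with ⟨a, x⟩
    rcases hej : e j with ⟨b, y⟩
    rw [hei, hej] at hb hij
    dsimp only at hb hij
    subst hb
    rw [h1 a _ _ hij]
  · have hb := hblock i j (Or.inl h)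
    have hij := hne i j h
    have hentry := he i j
    rw [if_neg hij] at hentry
    have p1 := hpos i j h
    have p2 := hpos j i h'
    have hij' : e i ≠ e j := fun h => hij (e.injective h)
    rcases hei : e i with ⟨a, x⟩
    rcases hej : e j with ⟨b, y⟩
    rw [hei, hej] at hb hentry hij'
    dsimp only at hb
    subst hb
    rw [Matrix.blockDiagonal'_apply_eq] at hentry
    have := h3 a x y (fun h => hij' (by rw [h]))
    omega
  · have hb := hblock i l hil
    have hb' := hblock j l hjl
    have n1 := (hent i l hil).ne
    have n2 := (hent j l hjl).ne
    apply e.injective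
    dsimp only at hi hj
    rcases hei : e i with ⟨a, x⟩
    rcases hej : e j with ⟨b, y⟩
    rcases hel : e l with ⟨c, z⟩
    rw [hei, hel] at hb hi n1
    rw [hej, hel] at hb' hj n2
    dsimp only at hb hb' hi hj
    subst hb
    subst hb'
    rw [Matrix.blockDiagonal'_apply_eq] at n1 n2
    rw [h4 b x y z hi hj n1 n2]

/-- A directed walk that has gone up must keep going up: at a peak both neighbours would be the
unique smaller one, giving opposite arrows. So a cycle cannot start upwards. If it starts downwards,
it must return to `v` from below, again through the same smaller neighbour. -/
theorem not_transGen_self (hV : IsDynkinQuiver V) (v : V) :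
    ¬Relation.TransGen (fun a b : V => Nonempty (a ⟶ b)) v v := by
  obtain ⟨ord, h1, h2⟩ := exists_order_vertices hV
  have up : ∀ a b c : V, Nonempty (a ⟶ b) → ord a < ord b →
      Relation.ReflTransGen (fun a b : V => Nonempty (a ⟶ b)) b c →
      ord a < ord c ∧ ∃ c', Nonempty (c' ⟶ c) ∧ ord c' < ord c := by
    intro a b c hab hlt hbc
    induction hbc with
    | refl => exact ⟨hlt, a, hab, hlt⟩
    | @tail c d _ hcd ih =>
      obtain ⟨ih1, c', hc', hlt'⟩ := ih
      have hcd' : ord c < ord d := by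
        refine lt_of_le_of_ne (not_lt.1 fun hdc => ?_) (h1 c d hcd).1
        have := h2 c' d c hlt' hdc (Or.inl hc') (Or.inr hcd)
        subst this
        exact (h1 _ _ hc').2 hcd
      exact ⟨ih1.trans hcd', c, hcd, hcd'⟩
  intro h
  obtain ⟨a, hva, hav⟩ := Relation.TransGen.head'_iff.1 h
  rcases lt_or_gt_of_ne (h1 v a hva).1 with hlt | hlt
  · exact lt_irrefl _ (up v a v hva hlt hav).1
  · have key : ∀ c : V, Relation.ReflTransGen (fun a b : V => Nonempty (a ⟶ b)) a c →
        ord c < ord v ∨ ∃ c', Nonempty (c' ⟶ c) ∧ ord c' < ord c := by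
      intro c hc
      induction hc with
      | refl => exact Or.inl hlt
      | @tail c d _ hcd ih =>
        rcases lt_or_gt_of_ne (h1 c d hcd).1 with hlt' | hlt'
        · exact Or.inr ⟨c, hcd, hlt'⟩
        · rcases ih with ih | ⟨c', hc', hlt''⟩
          · exact Or.inl (hlt'.trans ih)
          · have := h2 c' d c hlt'' hlt' (Or.inl hc') (Or.inr hcd)
            subst this
            exact absurd hcd (h1 _ _ hc').2
    rcases key v hav with h' | ⟨b, hbv, hlt'⟩
    · exact lt_irrefl _ h'
    · have := h2 a b v hlt hlt' (Or.inr hva) (Or.inl hbv)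
      subst this
      exact (h1 _ _ hva).2 hbv

theorem finite_paths [Finite V] (hV : IsDynkinQuiver V) : Finite (QuiverPaths V) := by
  let r : V → V → Prop := Relation.TransGen fun a b : V => Nonempty (a ⟶ b)
  have : Std.Irrefl r := ⟨not_transGen_self hV⟩
  have wf : WellFounded r := Finite.wellFounded_of_trans_of_irrefl r
  have hfin := hV.1
  have key : ∀ b : V, Finite (Σ a : V, Quiver.Path a b) := by
    intro b
    induction b using wf.induction with
    | _ b ih =>
    have h1 : ∀ c : V, Finite ((Σ a : V, Quiver.Path a c) × (c ⟶ b)) := fun c => by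
      rcases isEmpty_or_nonempty (c ⟶ b) with h | h
      · infer_instance
      · have := ih c (Relation.TransGen.single h)
        infer_instance
    let f : Option (Σ c : V, (Σ a : V, Quiver.Path a c) × (c ⟶ b)) → Σ a : V, Quiver.Path a b
      | none => ⟨b, Quiver.Path.nil⟩
      | some ⟨_, ⟨a, p⟩, e⟩ => ⟨a, p.cons e⟩
    refine Finite.of_surjective f ?_
    rintro ⟨a, p⟩
    cases p with
    | nil => exact ⟨none, rfl⟩
    | cons p e => exact ⟨some ⟨_, ⟨a, p⟩, e⟩, rfl⟩
  let g : (Σ b : V, Σ a : V, Quiver.Path a b) → QuiverPaths V := fun x => ⟨x.2.1, x.1, x.2.2⟩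
  exact Finite.of_surjective g fun x => ⟨⟨x.2.1, x.1, x.2.2⟩, rfl⟩

end IsDynkinQuiver

end

noncomputable section

/-! ### Rigid cogenerating modules are tilting -/

section Tilting

variable {A : Type u} [Ring A]

/-- Finitely generated projective modules are direct summands of finite sums of copies of `A`. -/
theorem exists_retract_regular (Q : RMod A) [Module.Finite Aᵐᵒᵖ Q] [Module.Projective Aᵐᵒᵖ Q] :
    ∃ k : ℕ, Nonempty (Retract Q (⨁ fun _ : Fin k => (ModuleCat.of Aᵐᵒᵖ A : RMod A))) := by
  obtain ⟨k, q, e, h⟩ := NakayamaObj.exists_dualBasis Q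
  let mulElt (x : Q) : (ModuleCat.of Aᵐᵒᵖ A : RMod A) ⟶ Q :=
    ModuleCat.ofHom ((LinearMap.toSpanSingleton Aᵐᵒᵖ Q x) ∘ₗ (regularEquiv A).symm.toLinearMap)
  refine ⟨k, ⟨⟨biproduct.lift fun i => ModuleCat.ofHom (e i), biproduct.desc fun i => mulElt (q i), ?_⟩⟩⟩
  rw [biproduct.lift_desc]
  ext x
  rw [ModuleCat.hom_sum, LinearMap.sum_apply]
  exact (h x).symm

theorem subsingleton_ext_projective (N Q : RMod A)
    [Module.Finite Aᵐᵒᵖ Q] [Module.Projective Aᵐᵒᵖ Q]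
    [Subsingleton (Abelian.Ext.{u} N (ModuleCat.of Aᵐᵒᵖ A : RMod A) 1)] :
    Subsingleton (Abelian.Ext.{u} N Q 1) := by
  obtain ⟨k, ⟨r⟩⟩ := exists_retract_regular Q
  have := ExtVanishing.biproduct_right (X := N) (Y := (ModuleCat.of Aᵐᵒᵖ A : RMod A)) 1 k
  exact ExtVanishing.of_retract_right 1 r

theorem hom_projective_eq_zero {N Q : RMod A} [Module.Finite Aᵐᵒᵖ Q] [Module.Projective Aᵐᵒᵖ Q]
    (h : ∀ f : N ⟶ ModuleCat.of Aᵐᵒᵖ A, f = 0) (f : N ⟶ Q) : f = 0 := by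
  obtain ⟨k, ⟨r⟩⟩ := exists_retract_regular Q
  have : f ≫ r.i = 0 := biproduct.hom_ext _ _ fun i => by rw [h (_ ≫ _), zero_comp]
  rw [← Category.comp_id f, ← r.retract, reassoc_of% this, zero_comp]

open FiniteModule

/-- `Ext¹(N, A) = 0` splits the projective resolution of `N`, so `N` embeds into a projective;
`Hom(N, A) = 0` then kills it. -/
theorem isCogenerating_regular [IsNoetherianRing Aᵐᵒᵖ] (hA : IsHereditary Aᵐᵒᵖ) :
    IsCogenerating (ModuleCat.of Aᵐᵒᵖ A : RMod A) := by
  intro N _ h0 h1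
  obtain ⟨Q, q, _, hQ, _⟩ := exists_presentation N
  have := hA N inferInstance
  have h2 := projective_kernel q
  have := finite_of_mono (kernel.ι q)
  have := (IsProjective.iff_projective _).2 h2
  have := (IsProjective.iff_projective _).2 hQ
  have := subsingleton_ext_projective N (kernel q)
  obtain ⟨r⟩ := @ExtVanishing.nonempty_retract_X₃ _ _ _ _ _ (ExtVanishing.shortExact_kernel q) this
  rw [IsZero.iff_id_eq_zero, ← r.retract]
  have : r.i = 0 := hom_projective_eq_zero (Q := Q) h0 _
  rw [this, zero_comp]

theorem isTiltingModule_of_isCogenerating (K : Type u) [Field K] [Algebra K A] [Module.Finite K A]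
    (hA : IsHereditary Aᵐᵒᵖ) (X : RMod A) [Module.Finite Aᵐᵒᵖ X]
    [Subsingleton (Abelian.Ext.{u} X X 1)] (hX : IsCogenerating X) : IsTiltingModule X := by
  have : IsArtinianRing Aᵐᵒᵖ := IsArtinianRing.of_finite K _
  have hproj : Projective (ModuleCat.of Aᵐᵒᵖ A : RMod A) :=
    (IsProjective.iff_projective _).1 (projective_regular A)
  have : Subsingleton (Abelian.Ext.{u} (ModuleCat.of Aᵐᵒᵖ A : RMod A) (ModuleCat.of Aᵐᵒᵖ A) 1) :=
    subsingleton_of_forall_eq 0 fun e => Abelian.Ext.eq_zero_of_projective e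
  exact ⟨inferInstance, hA X inferInstance, inferInstance,
    encard_indecSummands_eq K hA (NakayamaObj.exists_mono_extInjective K) X _ hX
      (isCogenerating_regular hA)⟩

end Tilting

end

noncomputable section

/-! ### Endomorphism algebras of two-term complexes -/

namespace TwoTerm

section Algebra

variable {K : Type*} [CommRing K] {E B C : Type*} [Ring E] [Ring B] [Ring C]
  [Algebra K E] [Algebra K B] [Algebra K C]

/-- Two algebras are isomorphic if they are related by a bijective correspondence. -/
theorem nonempty_algEquiv_of_correspondence (q : E →ₐ[K] B) (hq : Function.Surjective q)
    (S : Subalgebra K (E × C)) (h1 : ∀ x, ∃ c, (x, c) ∈ S) (h2 : ∀ c, ∃ x, (x, c) ∈ S)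
    (h3 : ∀ x c, (x, c) ∈ S → (q x = 0 ↔ c = 0)) : Nonempty (B ≃ₐ[K] C) := by
  let S' : Subalgebra K (B × C) := S.map (q.prodMap (AlgHom.id K C))
  have hS' : ∀ b c, (b, c) ∈ S' → (b = 0 ↔ c = 0) := by
    rintro b c ⟨⟨x, c'⟩, hx, h⟩
    obtain ⟨rfl, rfl⟩ := Prod.ext_iff.1 h
    exact h3 x c' hx
  have b1 : Function.Bijective ((AlgHom.fst K B C).comp S'.val) := by
    refine ⟨(injective_iff_map_eq_zero _).2 ?_, fun b => ?_⟩
    · rintro ⟨⟨b, c⟩, h⟩ (rfl : b = 0)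
      obtain rfl := (hS' _ _ h).1 rfl
      rfl
    · obtain ⟨x, rfl⟩ := hq b
      obtain ⟨c, hc⟩ := h1 x
      exact ⟨⟨(q x, c), ⟨(x, c), hc, rfl⟩⟩, rfl⟩
  have b2 : Function.Bijective ((AlgHom.snd K B C).comp S'.val) := by
    refine ⟨(injective_iff_map_eq_zero _).2 ?_, fun c => ?_⟩
    · rintro ⟨⟨b, c⟩, h⟩ (rfl : c = 0)
      obtain rfl := (hS' _ _ h).2 rfl
      rfl
    · obtain ⟨x, hx⟩ := h2 c
      exact ⟨⟨(q x, c), ⟨(x, c), hx, rfl⟩⟩, rfl⟩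
  exact ⟨(AlgEquiv.ofBijective _ b1).symm.trans (AlgEquiv.ofBijective _ b2)⟩

end Algebra

variable (K : Type*) [Field K] {C : Type*} [Category C] [Abelian C] [Linear K C]
  {T : CochainComplex C ℤ}

/-- Passing to the homotopy category, on endomorphism algebras. -/
def endToHo (T : CochainComplex C ℤ) : End T →ₐ[K] End (toHo T) :=
  AlgHom.ofLinearMap ((HomotopyCategory.quotient C (ComplexShape.up ℤ)).mapLinearMap K)
    ((HomotopyCategory.quotient C (ComplexShape.up ℤ)).map_id T)
    fun f g => (HomotopyCategory.quotient C (ComplexShape.up ℤ)).map_comp g f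

theorem endToHo_surjective (T : CochainComplex C ℤ) : Function.Surjective (endToHo K T) :=
  (HomotopyCategory.quotient C (ComplexShape.up ℤ)).map_surjective

theorem endToHo_eq_zero_iff (hT : IsTwoTerm T) (φ : End T) : endToHo K T φ = 0 ↔
    ∃ s : T.X 0 ⟶ T.X (-1), φ.f (-1) = T.d (-1) 0 ≫ s ∧ φ.f 0 = s ≫ T.d (-1) 0 :=
  quotient_map_eq_zero_iff hT hT φ

/-- The endomorphisms of a two-term projective resolution, up to homotopy. -/
theorem nonempty_algEquiv_of_shortExact (hT : IsTwoTerm T) [Projective (T.X 0)] {M : C}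
    (π : T.X 0 ⟶ M) (w : T.d (-1) 0 ≫ π = 0) (hS : (ShortComplex.mk _ _ w).ShortExact) :
    Nonempty (End (toHo T) ≃ₐ[K] End M) := by
  have hepi : Epi π := hS.epi_g
  have hmono : Mono (T.d (-1) 0) := hS.mono_f
  -- `S` is the algebra of pairs `(φ, c)` such that `φ` lifts `c`; using this relation avoids
  -- choosing lifts multiplicatively.
  let S : Subalgebra K (End T × End M) :=
    { carrier := {p | π ≫ p.2 = p.1.f 0 ≫ π}
      mul_mem' := fun {a b} (ha : _ = _) (hb : _ = _) => by
        change π ≫ b.2 ≫ a.2 = (b.1 ≫ a.1).f 0 ≫ π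
        rw [reassoc_of% hb, ha, HomologicalComplex.comp_f, Category.assoc]
      add_mem' := fun {a b} (ha : _ = _) (hb : _ = _) => by
        change π ≫ (a.2 + b.2) = (a.1 + b.1).f 0 ≫ π
        rw [Preadditive.comp_add, ha, hb, HomologicalComplex.add_f_apply, Preadditive.add_comp]
      algebraMap_mem' := fun r => by
        change π ≫ (r • 𝟙 M) = (r • 𝟙 T : T ⟶ T).f 0 ≫ π
        simp }
  refine nonempty_algEquiv_of_correspondence (endToHo K T) (endToHo_surjective K T) S
    (fun φ => ?_) (fun c => ?_) (fun φ c h => ?_)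
  · have : T.d (-1) 0 ≫ φ.f 0 ≫ π = 0 := by rw [← φ.comm_assoc, w, comp_zero]
    exact ⟨hS.exact.desc _ this, hS.exact.g_desc _ this⟩
  · have h0 : Projective.factorThru (π ≫ c) π ≫ π = π ≫ c := Projective.factorThru_comp _ _
    have h1 : (T.d (-1) 0 ≫ Projective.factorThru (π ≫ c) π) ≫ π = 0 := by
      rw [Category.assoc, h0, reassoc_of% w, zero_comp]
    obtain ⟨φ, -, h⟩ := exists_hom hT hT (hS.exact.lift _ h1) (Projective.factorThru (π ≫ c) π)
      (hS.exact.lift_f _ h1)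
    exact ⟨φ, by change π ≫ c = φ.f 0 ≫ π; rw [h, h0]⟩
  · change π ≫ c = φ.f 0 ≫ π at h
    rw [endToHo_eq_zero_iff K hT]
    constructor
    · rintro ⟨s, -, hs⟩
      rwa [hs, Category.assoc, w, comp_zero, ← comp_zero (f := π), cancel_epi] at h
    · rintro rfl
      rw [comp_zero] at h
      have hs := hS.exact.lift_f (φ.f 0) h.symm
      refine ⟨hS.exact.lift _ h.symm, ?_, hs.symm⟩
      rw [← cancel_mono (T.d (-1) 0), Category.assoc]
      erw [hs]
      exact φ.comm (-1) 0

/-- The endomorphisms of a two-term complex which is sent to an injective coresolution by a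
fully faithful functor. -/
theorem nonempty_algEquiv_of_injective (F : C ⥤ C) [F.Additive] [F.Linear K] (hT : IsTwoTerm T)
    (hinj : Injective (F.obj (T.X (-1))))
    (hfull : ∀ i j (g : F.obj (T.X i) ⟶ F.obj (T.X j)), ∃ f, F.map f = g)
    (hfaith : ∀ i j (f : T.X i ⟶ T.X j), F.map f = 0 → f = 0) {X : C}
    (ι : X ⟶ F.obj (T.X (-1))) (w : ι ≫ F.map (T.d (-1) 0) = 0)
    (hS : (ShortComplex.mk _ _ w).ShortExact) : Nonempty (End (toHo T) ≃ₐ[K] End X) := by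
  have hepi : Epi (F.map (T.d (-1) 0)) := hS.epi_g
  have hmono : Mono ι := hS.mono_f
  have hfaith' : ∀ i j (f g : T.X i ⟶ T.X j), F.map f = F.map g → f = g := fun i j f g h =>
    sub_eq_zero.1 (hfaith i j _ (by rw [F.map_sub, h, sub_self]))
  let S : Subalgebra K (End T × End X) :=
    { carrier := {p | p.2 ≫ ι = ι ≫ F.map (p.1.f (-1))}
      mul_mem' := fun {a b} (ha : _ = _) (hb : _ = _) => by
        change (b.2 ≫ a.2) ≫ ι = ι ≫ F.map ((b.1 ≫ a.1).f (-1))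
        rw [Category.assoc, ha, reassoc_of% hb, HomologicalComplex.comp_f, F.map_comp]
      add_mem' := fun {a b} (ha : _ = _) (hb : _ = _) => by
        change (a.2 + b.2) ≫ ι = ι ≫ F.map ((a.1 + b.1).f (-1))
        rw [Preadditive.add_comp, ha, hb, HomologicalComplex.add_f_apply, F.map_add,
          Preadditive.comp_add]
      algebraMap_mem' := fun r => by
        change (r • 𝟙 X) ≫ ι = ι ≫ F.map ((r • 𝟙 T : T ⟶ T).f (-1))
        simp }
  refine nonempty_algEquiv_of_correspondence (endToHo K T) (endToHo_surjective K T) S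
    (fun φ => ?_) (fun c => ?_) (fun φ c h => ?_)
  · have : (ι ≫ F.map (φ.f (-1))) ≫ F.map (T.d (-1) 0) = 0 := by
      rw [Category.assoc, ← F.map_comp, φ.comm, F.map_comp, reassoc_of% w, zero_comp]
    exact ⟨hS.exact.lift _ this, hS.exact.lift_f _ this⟩
  · obtain ⟨f₁, hf₁⟩ := hfull _ _ (Injective.factorThru (c ≫ ι) ι)
    have h1 : ι ≫ F.map f₁ = c ≫ ι := by rw [hf₁, Injective.comp_factorThru]
    have h2 : ι ≫ F.map (f₁ ≫ T.d (-1) 0) = 0 := by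
      rw [F.map_comp, reassoc_of% h1, w, comp_zero]
    obtain ⟨f₀, hf₀⟩ := hfull _ _ (hS.exact.desc _ h2)
    obtain ⟨φ, h, -⟩ := exists_hom hT hT f₁ f₀ (hfaith' _ _ _ _ (by
      rw [F.map_comp (T.d (-1) 0), hf₀]
      exact (hS.exact.g_desc _ h2).symm))
    exact ⟨φ, by change c ≫ ι = ι ≫ F.map (φ.f (-1)); rw [h, h1]⟩
  · change c ≫ ι = ι ≫ F.map (φ.f (-1)) at h
    rw [endToHo_eq_zero_iff K hT]
    constructor
    · rintro ⟨s, hs, -⟩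
      rwa [hs, F.map_comp, reassoc_of% w, zero_comp, ← zero_comp (f := ι), cancel_mono] at h
    · rintro rfl
      rw [zero_comp] at h
      obtain ⟨s, hs⟩ := hfull _ _ (hS.exact.desc (F.map (φ.f (-1))) h.symm)
      have h1 : φ.f (-1) = T.d (-1) 0 ≫ s := hfaith' _ _ _ _ (by
        rw [F.map_comp, hs]
        exact (hS.exact.g_desc _ h.symm).symm)
      refine ⟨s, h1, hfaith' _ _ _ _ ?_⟩
      rw [← cancel_epi (F.map (T.d (-1) 0)), ← F.map_comp, ← F.map_comp, ← φ.comm (-1) 0, h1,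
        Category.assoc]

end TwoTerm

end

noncomputable section

namespace TwoTerm

/-! ### Two-term resolutions and coresolutions -/

section Abelian

variable {C : Type*} [Category C] [Abelian C]

theorem exists_quasiIso_single {Z : CochainComplex C ℤ} (hZ : ∀ i : ℤ, i ≠ 0 → i ≠ 1 → IsZero (Z.X i))
    {X : C} (ι : X ⟶ Z.X 0) (w : ι ≫ Z.d 0 1 = 0) (hS : (ShortComplex.mk _ _ w).ShortExact) :
    ∃ g : (HomologicalComplex.single C (ComplexShape.up ℤ) 0).obj X ⟶ Z, QuasiIso g := by
  have hepi : Epi (Z.d 0 1) := hS.epi_g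
  have hmono : Mono ι := hS.mono_f
  have hι : ∀ j, (ComplexShape.up ℤ).Rel 0 j → ι ≫ Z.d 0 j = 0 := by
    rintro j (rfl : (0 : ℤ) + 1 = j)
    exact w
  refine ⟨HomologicalComplex.mkHomFromSingle ι hι, ?_⟩
  rw [quasiIso_iff]
  intro i
  by_cases hi : i = 0
  · subst hi
    rw [quasiIsoAt_iff' _ (-1) 0 1 (by simp) (by simp), ShortComplex.quasiIso_iff_of_zeros]
    · let e : ShortComplex.mk ι (Z.d 0 1) w ≅ ShortComplex.mk
          ((HomologicalComplex.singleObjXSelf (ComplexShape.up ℤ) 0 X).hom ≫ ι) (Z.d 0 1)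
          (by rw [Category.assoc, w, comp_zero]) :=
        ShortComplex.isoMk (HomologicalComplex.singleObjXSelf (ComplexShape.up ℤ) 0 X).symm
          (Iso.refl _) (Iso.refl _)
      constructor
      · refine ShortComplex.exact_of_iso (e ≪≫ ShortComplex.isoMk (Iso.refl _) (Iso.refl _)
          (Iso.refl _) ?_ ?_) hS.exact
        · simp only [Iso.refl_hom, HomologicalComplex.shortComplexFunctor'_map_τ₂,
            HomologicalComplex.mkHomFromSingle_f]
          exact (Category.id_comp _).trans (Category.comp_id _).symm
        · exact (Category.id_comp _).trans (Category.comp_id _).symm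
      · change Mono ((HomologicalComplex.mkHomFromSingle ι hι).f 0)
        rw [HomologicalComplex.mkHomFromSingle_f]
        infer_instance
    · exact (HomologicalComplex.isZero_single_obj_X (.up ℤ) 0 X _ (show (-1 : ℤ) ≠ 0 by decide)).eq_of_src _ _
    · exact (HomologicalComplex.isZero_single_obj_X (.up ℤ) 0 X _ (show (1 : ℤ) ≠ 0 by decide)).eq_of_tgt _ _
    · exact (hZ (-1) (by omega) (by omega)).eq_of_src _ _
  · rw [quasiIsoAt_iff_exactAt _ _ (HomologicalComplex.exactAt_single_obj _ _ _ _ hi)]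
    by_cases hi1 : i = 1
    · subst hi1
      rw [HomologicalComplex.exactAt_iff' _ 0 1 2 (by simp) (by simp)]
      refine (ShortComplex.exact_iff_epi _ ?_).2 hepi
      exact (hZ 2 (by omega) (by omega)).eq_of_tgt _ _
    · exact ShortComplex.exact_of_isZero_X₂ _ (hZ i hi hi1)

/-- Absorbs the sign that the shift puts on the differential. -/
theorem exists_iso_neg {X Y : C} (e : X ≅ Y) : ∃ e' : X ≅ Y, e'.hom = -e.hom :=
  ⟨⟨-e.hom, -e.inv, by simp, by simp⟩, rfl⟩

theorem exists_quasiIso_single_shift {Z : CochainComplex C ℤ} (hZ : IsTwoTerm Z) {X : C}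
    (ι : X ⟶ Z.X (-1)) (w : ι ≫ Z.d (-1) 0 = 0) (hS : (ShortComplex.mk _ _ w).ShortExact) :
    ∃ g : (HomologicalComplex.single C (ComplexShape.up ℤ) 0).obj X ⟶ Z⟦(-1 : ℤ)⟧, QuasiIso g := by
  obtain ⟨e₀, e₁, hd⟩ : ∃ (e₀ : (Z⟦(-1 : ℤ)⟧).X 0 ≅ Z.X (-1)) (e₁ : (Z⟦(-1 : ℤ)⟧).X 1 ≅ Z.X 0),
      (Z⟦(-1 : ℤ)⟧).d 0 1 = -(e₀.hom ≫ Z.d (-1) 0 ≫ e₁.inv) := by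
    refine ⟨CochainComplex.shiftFunctorObjXIso Z (-1) 0 (-1) rfl,
      CochainComplex.shiftFunctorObjXIso Z (-1) 1 0 rfl, ?_⟩
    simp [CochainComplex.shiftFunctor_obj_d', CochainComplex.shiftFunctorObjXIso]
    rfl
  have w' : (ι ≫ e₀.inv) ≫ (Z⟦(-1 : ℤ)⟧).d 0 1 = 0 := by
    rw [hd, Preadditive.comp_neg, Category.assoc, e₀.inv_hom_id_assoc, reassoc_of% w, zero_comp,
      neg_zero]
  refine exists_quasiIso_single (Z := Z⟦(-1 : ℤ)⟧) (fun i h0 h1 => ?_) (ι ≫ e₀.inv) w' ?_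
  · exact hZ (i + -1) (by omega) (by omega)
  · obtain ⟨e, he⟩ := exists_iso_neg e₁.symm
    refine ShortComplex.shortExact_of_iso ?_ hS
    refine ShortComplex.isoMk (Iso.refl _) e₀.symm e (Category.id_comp _) ?_
    change e₀.inv ≫ (Z⟦(-1 : ℤ)⟧).d 0 1 = Z.d (-1) 0 ≫ e.hom
    rw [hd, he, Preadditive.comp_neg, Preadditive.comp_neg, e₀.inv_hom_id_assoc]
    rfl

theorem quasiIsoAt_biprod_fst (X Y : CochainComplex C ℤ) (i : ℤ) (hY : Y.ExactAt i) :
    QuasiIsoAt (biprod.fst : X ⊞ Y ⟶ X) i := by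
  rw [quasiIsoAt_iff_isIso_homologyMap]
  let F := HomologicalComplex.homologyFunctor C (ComplexShape.up ℤ) i
  have h0 : IsZero (F.obj Y) := hY.isZero_homology
  change IsIso (F.map (biprod.fst : X ⊞ Y ⟶ X))
  refine ⟨F.map biprod.inl, ?_, ?_⟩
  · have h1 : F.map (biprod.snd : X ⊞ Y ⟶ Y) = 0 := h0.eq_of_tgt _ _
    have h2 := F.congr_map (biprod.total (X := X) (Y := Y))
    rwa [F.map_add, F.map_comp, F.map_comp, h1, zero_comp, add_zero, F.map_id] at h2
  · rw [← F.map_comp, biprod.inl_fst, F.map_id]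

/-- The projection of `M ⊕ P[1]` to `M` is a quasi-isomorphism away from degree `-1`, and everywhere
if `P = 0`. Degree `0` identifies `M` with the cokernel of `d`; degree `-1` then says that `d` is
mono. -/
theorem exists_exact_of_quasiIso {T : CochainComplex C ℤ} (hT : IsTwoTerm T) {M P : C}
    (f : T ⟶ (HomologicalComplex.single C (ComplexShape.up ℤ) 0).obj M ⊞
      (HomologicalComplex.single C (ComplexShape.up ℤ) (-1)).obj P) [QuasiIso f] :
    ∃ (π : T.X 0 ⟶ M) (w : T.d (-1) 0 ≫ π = 0), (ShortComplex.mk _ _ w).Exact ∧ Epi π ∧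
      (IsZero P → Mono (T.d (-1) 0)) := by
  let g := f ≫ biprod.fst
  have hg : ∀ i : ℤ, (i ≠ -1 ∨ IsZero P) → QuasiIsoAt g i := fun i hi => by
    have : QuasiIsoAt (biprod.fst : (HomologicalComplex.single C (ComplexShape.up ℤ) 0).obj M ⊞
        (HomologicalComplex.single C (ComplexShape.up ℤ) (-1)).obj P ⟶ _) i := by
      refine quasiIsoAt_biprod_fst _ _ _ ?_
      rcases hi with hi | hi
      · exact HomologicalComplex.exactAt_single_obj _ _ _ _ hi
      · refine ShortComplex.exact_of_isZero_X₂ _ ?_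
        exact (HomologicalComplex.eval C (ComplexShape.up ℤ) i).map_isZero
          ((HomologicalComplex.single C (ComplexShape.up ℤ) (-1)).map_isZero hi)
    infer_instance
  have h0 := hg 0 (Or.inl (by omega))
  rw [quasiIsoAt_iff' _ (-1) 0 1 (by simp) (by simp), ShortComplex.quasiIso_iff_of_zeros'] at h0
  rotate_left
  · exact (hT 1 (by omega) (by omega)).eq_of_tgt _ _
  · exact (HomologicalComplex.isZero_single_obj_X (.up ℤ) 0 M _ (show (-1 : ℤ) ≠ 0 by decide)).eq_of_src _ _
  · exact (HomologicalComplex.isZero_single_obj_X (.up ℤ) 0 M _ (show (1 : ℤ) ≠ 0 by decide)).eq_of_tgt _ _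
  obtain ⟨h1, h2⟩ := h0
  let σ := HomologicalComplex.singleObjXSelf (ComplexShape.up ℤ) 0 M
  have hepi : Epi (g.f 0) := h2
  have w : T.d (-1) 0 ≫ g.f 0 ≫ σ.hom = 0 := by
    rw [← g.comm_assoc, (HomologicalComplex.isZero_single_obj_X (.up ℤ) 0 M _
      (show (-1 : ℤ) ≠ 0 by decide)).eq_of_tgt (g.f (-1)) 0, zero_comp]
  refine ⟨g.f 0 ≫ σ.hom, w, ?_, inferInstance, fun hP => ?_⟩
  · refine ShortComplex.exact_of_iso ?_ h1
    exact ShortComplex.isoMk (Iso.refl _) (Iso.refl _) σ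
      ((Category.id_comp _).trans (Category.comp_id _).symm) (Category.id_comp _)
  · have h3 := hg (-1) (Or.inr hP)
    rw [quasiIsoAt_iff_exactAt' _ _ (HomologicalComplex.exactAt_single_obj _ _ _ _ (by omega)),
      HomologicalComplex.exactAt_iff' _ (-2) (-1) 0 (by simp) (by simp)] at h3
    exact (ShortComplex.exact_iff_mono _ ((hT (-2) (by omega) (by omega)).eq_of_src _ _)).1 h3

end Abelian

section Ext

variable {C : Type*} [Category C] [Abelian C] [HasExt C] {U Z : CochainComplex C ℤ}

/-- If `N` is left orthogonal to `M`, then a two-term projective resolution of `N` is left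
orthogonal to all shifts of a two-term projective resolution of `M`. -/
theorem hom_shift_eq_zero_of_resolution (hU : IsTwoTerm U) (hZ : IsTwoTerm Z)
    [Projective (U.X 0)] {N M : C} (p : U.X 0 ⟶ N) (wp : U.d (-1) 0 ≫ p = 0)
    (hp : (ShortComplex.mk _ _ wp).ShortExact) (π : Z.X 0 ⟶ M) (wπ : Z.d (-1) 0 ≫ π = 0)
    (hπ : (ShortComplex.mk _ _ wπ).ShortExact) (h0 : ∀ f : N ⟶ M, f = 0)
    (h1 : Subsingleton (Abelian.Ext N M 1)) (n : ℤ) (f : toHo U ⟶ (toHo Z)⟦n⟧) : f = 0 := by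
  have hepi : Epi π := hπ.epi_g
  have hmono : Mono (Z.d (-1) 0) := hπ.mono_f
  have := hp.epi_g
  refine forall_hom_shift_eq_zero hU hZ (fun h => ?_) (fun f₁ f₀ h => ?_) (fun g _ hg => ?_) n f
  · obtain ⟨g, hg⟩ := @ExtVanishing.exists_desc _ _ _ _ _ hp M h1 (h ≫ π)
    have hg' : U.d (-1) 0 ≫ g = h ≫ π := hg
    have hl : Projective.factorThru g π ≫ π = g := Projective.factorThru_comp _ _
    have h2 : (h - U.d (-1) 0 ≫ Projective.factorThru g π) ≫ π = 0 := by
      rw [Preadditive.sub_comp, Category.assoc, hl, hg', sub_self]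
    refine ⟨hπ.exact.lift _ h2, Projective.factorThru g π, ?_⟩
    exact (sub_eq_iff_eq_add.1 (hπ.exact.lift_f _ h2).symm)
  · have h2 : U.d (-1) 0 ≫ f₀ ≫ π = 0 := by rw [← reassoc_of% h, wπ, comp_zero]
    have h3 : f₀ ≫ π = 0 := by
      rw [← hp.exact.g_desc _ h2, h0 (hp.exact.desc _ h2), comp_zero]
    have h4 : hπ.exact.lift _ h3 ≫ Z.d (-1) 0 = f₀ := hπ.exact.lift_f _ h3
    refine ⟨hπ.exact.lift _ h3, ?_, h4.symm⟩
    rw [← cancel_mono (Z.d (-1) 0), Category.assoc, h4, h]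
  · rwa [← zero_comp (X := U.X 0) (f := Z.d (-1) 0), cancel_mono] at hg

/-- If `N` is left orthogonal to `X`, then `N[1]` is left orthogonal to all shifts of a two-term
coresolution of `X`. -/
theorem hom_shift_eq_zero_of_coresolution (hU : IsTwoTerm U) (hU' : IsZero (U.X 0))
    (hZ : IsTwoTerm Z) {X : C} (ι : X ⟶ Z.X (-1)) (w : ι ≫ Z.d (-1) 0 = 0)
    (hS : (ShortComplex.mk _ _ w).ShortExact) (h0 : ∀ f : U.X (-1) ⟶ X, f = 0)
    (h1 : Subsingleton (Abelian.Ext (U.X (-1)) X 1)) (n : ℤ) (f : toHo U ⟶ (toHo Z)⟦n⟧) :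
    f = 0 := by
  have hmono : Mono ι := hS.mono_f
  refine forall_hom_shift_eq_zero hU hZ (fun h => ?_) (fun f₁ f₀ h => ?_)
    (fun g _ _ => hU'.eq_of_src _ _) n f
  · obtain ⟨g, hg⟩ := @ExtVanishing.exists_lift _ _ _ _ _ hS _ h1 h
    exact ⟨g, 0, by rw [comp_zero, add_zero]; exact hg.symm⟩
  · have h2 : f₁ ≫ Z.d (-1) 0 = 0 := by rw [h, hU'.eq_of_src f₀ 0, comp_zero]
    refine ⟨0, ?_, hU'.eq_of_src _ _⟩
    rw [← hS.exact.lift_f _ h2, h0 (hS.exact.lift _ h2), zero_comp, comp_zero]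

end Ext

end TwoTerm

end

noncomputable section

/-! ### Two-term silting complexes over hereditary algebras -/

namespace IsTwoTermSilting

open FiniteModule TwoTerm

variable {A : Type u} [Ring A] {T : RCpx A}

theorem exists_eq_add (hT : IsTwoTermSilting T) (h : T.X (-1) ⟶ T.X 0) :
    ∃ (a : T.X (-1) ⟶ T.X (-1)) (b : T.X 0 ⟶ T.X 0), h = a ≫ T.d (-1) 0 + T.d (-1) 0 ≫ b :=
  (hom_shift_one_eq_zero_iff hT.two_term hT.two_term).1 (hT.hom_eq_zero 1 one_pos) h

theorem projective (hT : IsTwoTermSilting T) (i : ℤ) : Projective (T.X i) :=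
  (IsProjective.iff_projective _).1 (hT.bounded_proj.1 i).2

/-- Finitely generated modules over hereditary rings have two-term resolutions by finitely generated
projective modules. -/
theorem exists_resolution [IsNoetherianRing Aᵐᵒᵖ] (hA : IsHereditary Aᵐᵒᵖ) (N : RMod A)
    [Module.Finite Aᵐᵒᵖ N] : ∃ (U : RCpx A) (p : U.X 0 ⟶ N) (w : U.d (-1) 0 ≫ p = 0),
      IsBoundedProj U ∧ IsTwoTerm U ∧ (ShortComplex.mk _ _ w).ShortExact := by
  obtain ⟨Q, q, _, hQ, _⟩ := exists_presentation N
  have := hA N inferInstance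
  have h2 := projective_kernel q
  have := finite_of_mono (kernel.ι q)
  have := (IsProjective.iff_projective _).2 h2
  have := (IsProjective.iff_projective _).2 hQ
  have hrel : (ComplexShape.up ℤ).Rel (-1) 0 := rfl
  have hne : (-1 : ℤ) ≠ 0 := by decide
  let U : RCpx A := HomologicalComplex.double (kernel.ι q) hrel
  let e₁ : U.X (-1) ≅ kernel q := HomologicalComplex.doubleXIso₀ (kernel.ι q) hrel
  let e₀ : U.X 0 ≅ Q := HomologicalComplex.doubleXIso₁ (kernel.ι q) hrel hne
  have hd : U.d (-1) 0 = e₁.hom ≫ kernel.ι q ≫ e₀.inv := HomologicalComplex.double_d _ hrel hne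
  have hzero : ∀ i : ℤ, i ≠ -1 → i ≠ 0 → IsZero (U.X i) :=
    HomologicalComplex.isZero_double_X _ hrel
  have w : U.d (-1) 0 ≫ e₀.hom ≫ q = 0 := by simp [hd]
  refine ⟨U, e₀.hom ≫ q, w, ⟨fun i => ?_, 1, fun i hi => hzero i ?_ ?_⟩, hzero, ?_⟩
  · by_cases h1 : i = -1
    · subst h1
      exact ⟨Module.Finite.equiv e₁.toLinearEquiv.symm,
        Module.Projective.of_equiv e₁.toLinearEquiv.symm⟩
    · by_cases h0 : i = 0
      · subst h0
        exact ⟨Module.Finite.equiv e₀.toLinearEquiv.symm,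
          Module.Projective.of_equiv e₀.toLinearEquiv.symm⟩
      · have := ModuleCat.isZero_iff_subsingleton.1 (hzero i h1 h0)
        exact ⟨inferInstance, inferInstance⟩
  · rintro rfl
    simp at hi
  · rintro rfl
    simp at hi
  · refine ShortComplex.shortExact_of_iso ?_ (ExtVanishing.shortExact_kernel q)
    exact ShortComplex.isoMk e₁.symm e₀.symm (Iso.refl _) (by simp [hd]) (by simp)

/-- If `T` is a two-term projective resolution of `M`, then `M` is cogenerating. -/
theorem isCogenerating_of_shortExact [IsNoetherianRing Aᵐᵒᵖ] (hA : IsHereditary Aᵐᵒᵖ)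
    (hT : IsTwoTermSilting T) {M : RMod A} (π : T.X 0 ⟶ M) (w : T.d (-1) 0 ≫ π = 0)
    (hS : (ShortComplex.mk _ _ w).ShortExact) : IsCogenerating M := by
  intro N _ h0 h1
  obtain ⟨U, p, wp, hU, hU', hp⟩ := exists_resolution hA N
  have hepi : Epi p := hp.epi_g
  have := (IsProjective.iff_projective _).1 (hU.1 0).2
  -- `U` is itself generated by `T`, so its identity is null-homotopic, and the homotopy shows that
  -- `p` vanishes.
  have key := TriangulatedOrthogonality.hom_eq_zero_of_triangEnvelope (𝟭 (RK A))
    (hom_shift_eq_zero_of_resolution hU' hT.two_term p wp hp π w hS h0 h1)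
    (hT.generates _ ⟨U, hU, ⟨Iso.refl _⟩⟩) 0
    (((shiftFunctorZero (RK A) ℤ).app (toK U)).inv)
  let e := (shiftFunctorZero (RK A) ℤ).app (toK U)
  have hid : (HomotopyCategory.quotient (RMod A) (ComplexShape.up ℤ)).map (𝟙 U) = 0 :=
    ((HomotopyCategory.quotient (RMod A) (ComplexShape.up ℤ)).map_id U).trans
      (e.inv_hom_id.symm.trans ((congrArg (· ≫ e.hom) key).trans zero_comp))
  obtain ⟨s, -, hs⟩ := (quotient_map_eq_zero_iff hU' hU' (𝟙 U)).1 hid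
  have hp0 : p = 0 := by
    rw [← Category.id_comp p]
    change (𝟙 U : U ⟶ U).f 0 ≫ p = 0
    rw [hs, Category.assoc, wp, comp_zero]
  rw [IsZero.iff_id_eq_zero, ← cancel_epi p, hp0, zero_comp, zero_comp]

section Algebra

variable (K : Type u) [Field K] [Algebra K A]

/-- The Nakayama functor, applied in each degree. -/
abbrev nu (T : RCpx A) : RCpx A :=
  ((nakayama K A).mapHomologicalComplex (ComplexShape.up ℤ)).obj T

theorem isTwoTerm_nu (hT : IsTwoTermSilting T) : IsTwoTerm (nu K T) :=
  fun i h1 h0 => (nakayama K A).map_isZero (hT.two_term i h1 h0)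

/-- If `ν T` is a coresolution of `X`, then `X` is cogenerating. -/
theorem isCogenerating_of_coresolution (hT : IsTwoTermSilting T) {X : RMod A}
    (ι : X ⟶ (nu K T).X (-1)) (w : ι ≫ (nu K T).d (-1) 0 = 0)
    (hS : (ShortComplex.mk _ _ w).ShortExact) : IsCogenerating X := by
  intro N _ h0 h1
  let U : RCpx A := (HomologicalComplex.single (RMod A) (ComplexShape.up ℤ) (-1)).obj N
  let e : U.X (-1) ≅ N := HomologicalComplex.singleObjXSelf (ComplexShape.up ℤ) (-1) N
  have hU : ∀ i : ℤ, i ≠ -1 → IsZero (U.X i) :=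
    HomologicalComplex.isZero_single_obj_X (ComplexShape.up ℤ) (-1) N
  let R : RMod A := ModuleCat.of Aᵐᵒᵖ A
  let Z : RCpx A := (HomologicalComplex.single (RMod A) (ComplexShape.up ℤ) 0).obj R
  let e' : Z.X 0 ≅ R := HomologicalComplex.singleObjXSelf (ComplexShape.up ℤ) 0 R
  have hZ : ∀ i : ℤ, i ≠ 0 → IsZero (Z.X i) :=
    HomologicalComplex.isZero_single_obj_X (ComplexShape.up ℤ) 0 R
  have hZ' : IsBoundedProj Z := by
    refine ⟨fun i => ?_, 0, fun i hi => hZ i (abs_pos.1 hi)⟩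
    by_cases h : i = 0
    · subst h
      exact ⟨Module.Finite.equiv e'.toLinearEquiv.symm,
        Module.Projective.of_equiv e'.toLinearEquiv.symm⟩
    · have := ModuleCat.isZero_iff_subsingleton.1 (hZ i h)
      exact ⟨inferInstance, inferInstance⟩
  have hνZ : IsTwoTerm (nu K Z) := fun i _ h => (nakayama K A).map_isZero (hZ i h)
  -- `N` sits in degree `-1` and `ν A` in degree `0`, so maps of degree `1` between these complexes
  -- are the maps `N ⟶ ν A`. They vanish because `T` generates `A`.
  have key := TriangulatedOrthogonality.hom_eq_zero_of_triangEnvelope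
    ((nakayama K A).mapHomotopyCategory (ComplexShape.up ℤ))
    (hom_shift_eq_zero_of_coresolution (U := U) (fun i h _ => hU i h) (hU 0 (by decide))
      (hT.isTwoTerm_nu K) ι w hS (fun f => by
        rw [← cancel_epi e.inv, h0 (e.inv ≫ f), comp_zero])
      (ExtVanishing.of_retract_left 1 (Retract.ofIso e)))
    (hT.generates _ ⟨Z, hZ', ⟨Iso.refl _⟩⟩) 1
  have key' := (hom_shift_one_eq_zero_iff (U := U) (fun i h _ => hU i h) hνZ).1 key
  refine NakayamaObj.isZero_of_hom_eq_zero K fun f => ?_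
  obtain ⟨G, hG⟩ : ∃ G : N ⟶ (nu K Z).X 0, G = f ≫ (nakayama K A).map e'.inv := ⟨_, rfl⟩
  obtain ⟨a, b, h⟩ := key' (e.hom ≫ G)
  have ha : a = 0 := ((nakayama K A).map_isZero (hZ (-1) (by decide))).eq_of_tgt _ _
  have hb : b = 0 := (hU 0 (by decide)).eq_of_src _ _
  rw [ha, hb, zero_comp, comp_zero, add_zero, Preadditive.IsIso.comp_left_eq_zero, hG] at h
  exact (Preadditive.IsIso.comp_right_eq_zero f ((nakayama K A).map e'.inv)).1 h

theorem exists_quasiIso_tau (hT : IsTwoTermSilting T) {X : RMod A}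
    (ι : X ⟶ (nu K T).X (-1)) (w : ι ≫ (nu K T).d (-1) 0 = 0)
    (hS : (ShortComplex.mk _ _ w).ShortExact) :
    ∃ g : (HomologicalComplex.single (RMod A) (ComplexShape.up ℤ) 0).obj X ⟶ tau K T,
      QuasiIso g :=
  exists_quasiIso_single_shift (hT.isTwoTerm_nu K) ι w hS

variable [Module.Finite K A]

/-- A two-term silting complex which is a projective resolution of a module. -/
theorem isTiltingModule_of_resolution (hA : IsHereditary Aᵐᵒᵖ) (hT : IsTwoTermSilting T)
    {M : RMod A} (π : T.X 0 ⟶ M) (w : T.d (-1) 0 ≫ π = 0)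
    (hS : (ShortComplex.mk _ _ w).ShortExact) :
    IsTiltingModule M ∧ Nonempty (End (toK T) ≃ₐ[K] End M) := by
  have : IsNoetherianRing Aᵐᵒᵖ := IsNoetherianRing.of_finite K _
  have hepi : Epi π := hS.epi_g
  have := hT.projective 0
  have := hT.projective (-1)
  have := (hT.bounded_proj.1 0).1
  have := finite_of_epi π
  have h1 : Subsingleton (Abelian.Ext.{u} (T.X 0) M 1) :=
    subsingleton_of_forall_eq 0 fun e => Abelian.Ext.eq_zero_of_projective e
  have : Subsingleton (Abelian.Ext.{u} M M 1) := by
    -- Lift `f : T⁻¹ ⟶ M` to `T⁻¹ ⟶ T⁰` and write the lift as `a ≫ d + d ≫ b`. The first term dies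
    -- in `M`, and the second shows that `f` extends to `T⁰`.
    refine @ExtVanishing.left_X₃ _ _ _ _ _ hS M h1 fun f => ?_
    obtain ⟨a, b, h⟩ := hT.exists_eq_add (Projective.factorThru f π)
    refine ⟨b ≫ π, ?_⟩
    rw [← Projective.factorThru_comp f π, h, Preadditive.add_comp, Category.assoc, w, comp_zero,
      zero_add, Category.assoc]
  exact ⟨isTiltingModule_of_isCogenerating K hA M (hT.isCogenerating_of_shortExact hA π w hS),
    nonempty_algEquiv_of_shortExact K hT.two_term π w hS⟩

/-- A two-term silting complex whose image under the Nakayama functor is a coresolution of a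
module. -/
theorem isTiltingModule_of_coresolution (hA : IsHereditary Aᵐᵒᵖ) (hT : IsTwoTermSilting T)
    {X : RMod A} (ι : X ⟶ (nu K T).X (-1)) (w : ι ≫ (nu K T).d (-1) 0 = 0)
    (hS : (ShortComplex.mk _ _ w).ShortExact) :
    IsTiltingModule X ∧ Nonempty (End (toK T) ≃ₐ[K] End X) := by
  have : IsNoetherianRing Aᵐᵒᵖ := IsNoetherianRing.of_finite K _
  have hmono : Mono ι := hS.mono_f
  have hfin := fun i => (hT.bounded_proj.1 i).1
  have hproj := fun i => (hT.bounded_proj.1 i).2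
  have hinj : ∀ i, Injective ((nu K T).X i) := fun i => NakayamaObj.injective_obj K (T.X i)
  have : Module.Finite Aᵐᵒᵖ ((nu K T).X (-1)) := NakayamaObj.finite_obj K (T.X (-1))
  have := finite_of_mono ι
  have h1 : Subsingleton (Abelian.Ext.{u} X ((nu K T).X (-1)) 1) :=
    subsingleton_of_forall_eq 0 fun e => Abelian.Ext.eq_zero_of_injective e
  have : Subsingleton (Abelian.Ext.{u} X X 1) := by
    -- Dually, extend `f` to `ν T⁻¹ ⟶ ν T⁰`, pull it back along the full functor `ν` and decompose
    -- it; the term starting with `ν d` vanishes on `X`.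
    refine @ExtVanishing.right_X₁ _ _ _ _ _ hS X h1 fun f => ?_
    let G : (nu K T).X (-1) ⟶ (nu K T).X 0 := Injective.factorThru f ι
    have hG : ι ≫ G = f := Injective.comp_factorThru f ι
    obtain ⟨g, hg⟩ := NakayamaObj.map_surjective K (P := T.X (-1)) (Q := T.X 0) G
    obtain ⟨a, b, h⟩ := hT.exists_eq_add g
    let a' : (nu K T).X (-1) ⟶ (nu K T).X (-1) := (nakayama K A).map a
    let b' : (nu K T).X 0 ⟶ (nu K T).X 0 := (nakayama K A).map b
    have hG' : G = a' ≫ (nu K T).d (-1) 0 + (nu K T).d (-1) 0 ≫ b' := by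
      rw [← hg, h, Functor.map_add, Functor.map_comp, Functor.map_comp]
      rfl
    refine ⟨ι ≫ a', ?_⟩
    change (ι ≫ a') ≫ (nu K T).d (-1) 0 = f
    rw [← hG, hG', Preadditive.comp_add, reassoc_of% w, zero_comp, add_zero, Category.assoc]
  exact ⟨isTiltingModule_of_isCogenerating K hA X (hT.isCogenerating_of_coresolution K ι w hS),
    nonempty_algEquiv_of_injective K (nakayama K A) hT.two_term (hinj (-1))
      (fun i j => NakayamaObj.map_surjective K) (fun i j => NakayamaObj.map_injective K) ι w hS⟩

end Algebra

end IsTwoTermSilting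

/-- Over a hereditary ring, a module without projective summands has no nonzero maps to `A`. -/
theorem HasNoProjectiveSummand.hom_eq_zero {A : Type u} [Ring A] [IsNoetherianRing Aᵐᵒᵖ]
    (hA : FiniteModule.IsHereditary Aᵐᵒᵖ) {M : RMod A} (hM : HasNoProjectiveSummand M)
    (f : M ⟶ ModuleCat.of Aᵐᵒᵖ A) : f = 0 := by
  have := FiniteModule.finite_of_epi (cokernel.π (image.ι f))
  have hproj : Projective (ModuleCat.of Aᵐᵒᵖ A : RMod A) :=
    (IsProjective.iff_projective _).1 (projective_regular A)
  have hI : Projective (image f) := by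
    rw [projective_iff_hasProjectiveDimensionLT_one]
    exact (ExtVanishing.shortExact_cokernel (image.ι f)).hasProjectiveDimensionLT_X₁ 1
      inferInstance (hA _ inferInstance)
  have h0 : IsZero (image f) := by
    refine hM (image f) ⟨⟨Projective.factorThru (𝟙 _) (factorThruImage f), factorThruImage f,
      Projective.factorThru_comp _ _⟩⟩ ((IsProjective.iff_projective _).2 hI)
  rw [← image.fac f, h0.eq_of_tgt (factorThruImage f) 0, zero_comp]

end

theorem mainTheorem8 {K : Type u} [Field K] [IsAlgClosed K]
    {V : Type u} [Fintype V] [DecidableEq V] [Quiver.{u} V] (hV : IsDynkinQuiver V)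
    (M P : RMod (PathAlgebra K V))
    (hM : Module.Finite (PathAlgebra K V)ᵐᵒᵖ M)
    (hP : Module.Finite (PathAlgebra K V)ᵐᵒᵖ P) (hP' : Module.Projective (PathAlgebra K V)ᵐᵒᵖ P)
    (T : RCpx (PathAlgebra K V)) (hT : IsTwoTermSilting T)
    (hTMP : ∃ f : T ⟶ modulePlusShift M P, QuasiIso f) :
    ((IsZero P ∨ HasNoProjectiveSummand M) → IsTiltedOfType K V (End (toK T))) ∧
    (IsZero P → IsTiltingModule M ∧ Nonempty (End (toK T) ≃ₐ[K] End M)) ∧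
    (HasNoProjectiveSummand M →
      ∃ X : RMod (PathAlgebra K V),
        (∃ g : (HomologicalComplex.single (RMod (PathAlgebra K V)) (ComplexShape.up ℤ) 0).obj X ⟶
          tau K T, QuasiIso g) ∧
        IsTiltingModule X ∧ Nonempty (End (toK T) ≃ₐ[K] End X)) := by
  have hfin : Finite (QuiverPaths V) := hV.finite_paths
  have hA := PathAlgebra.isHereditary K (V := V)
  have : IsNoetherianRing (PathAlgebra K V)ᵐᵒᵖ := IsNoetherianRing.of_finite K _
  obtain ⟨f, hf⟩ := hTMP
  obtain ⟨π, w, hex, hepi, hmono⟩ :=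
    @TwoTerm.exists_exact_of_quasiIso _ _ _ _ hT.two_term M P f hf
  have case₁ : IsZero P → IsTiltingModule M ∧ Nonempty (End (toK T) ≃ₐ[K] End M) := fun hP => by
    have := hmono hP
    exact hT.isTiltingModule_of_resolution K hA π w ⟨hex⟩
  have case₂ : HasNoProjectiveSummand M →
      ∃ X : RMod (PathAlgebra K V),
        (∃ g : (HomologicalComplex.single (RMod (PathAlgebra K V)) (ComplexShape.up ℤ) 0).obj X ⟶
          tau K T, QuasiIso g) ∧
        IsTiltingModule X ∧ Nonempty (End (toK T) ≃ₐ[K] End X) := fun hM => by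
    -- A map `T⁰ ⟶ A` killed by `d` factors through `M`, hence vanishes.
    have hν : Epi ((IsTwoTermSilting.nu K T).d (-1) 0) :=
      NakayamaObj.epi_map K (T.d (-1) 0) fun g hg => by
        rw [← hex.g_desc g hg, hM.hom_eq_zero hA (hex.desc g hg), comp_zero]
    have hS := ExtVanishing.shortExact_kernel ((IsTwoTermSilting.nu K T).d (-1) 0)
    exact ⟨_, hT.exists_quasiIso_tau K _ _ hS, hT.isTiltingModule_of_coresolution K hA _ _ hS⟩
  refine ⟨fun h => ?_, case₁, case₂⟩
  rcases h with hP | hM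
  · exact ⟨M, case₁ hP⟩
  · obtain ⟨X, -, hX⟩ := case₂ hM
    exact ⟨X, hX⟩
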